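/- Let $m,s\ge 2$ be integers. For integers $a\le b+1$, call the $ms$-pyramid with base $[a,b]$ the set of integers $msi+j$ with $i\ge 0$, $0\le j\le ms-1$ and $a+i\le j\le b-i$. Let $\mathcal L_m(s)$ be the union of the $ms$-pyramids with bases $[(k-1)s+1,ks-1]$ for $1\le k\le m-1$ and of the $ms$-pyramid with base $[(m-1)s+1,ms-2]$. For a finite nonempty set $S\subseteq\mathcal L_m(s)$ put $$f(S)=\sum_{x\in S}x-\frac{|S|(|S|-1)}2,\qquad t=t(S)=\min\{i\ge 1: S\subseteq[0,ims-1]\},$$ and for $i\ge1$ put $\mathcal B_i=S\cap[(i-1)s,is-1]$, $a_i=|\mathcal B_i|$ and $n_i=\max\{x \bmod s: x\in\mathcal B_i\}$ (with $n_i=0$ if $\mathcal B_i=\emptyset$). Call $S$ a generalized-$\beta$-set if: 1. if $1\le i<\lceil (s-1)/2\rceil m$ and $a_i=0$, then $a_{i+1}=0$; 2. if $1\le i<tm$ and $m\nmid i$, then $a_i\ge a_{i+1}$; 3. if $1\le i\le (t-1)m$ and $a_{i+m}>0$, then $a_{i+m}\le a_i-2$; 4. if $1\le i<tm$, $m\nmid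 i$ and $a_{i+1}>0$, then $n_i\ge n_{i+1}$; 5. if $1\le i<tm$, $m\nmid i$ and $a_i=a_{i+1}>0$, then $n_i=n_{i+1}$; 6. if $t\ge2$, then $a_{(t-1)m}\ge a_{(t-1)m+1}$. Theorem. Call a generalized-$\beta$-set $S\subseteq\mathcal L_m(s)$ a maximizer if $f(S)\ge f(S')$ for every generalized-$\beta$-set $S'\subseteq\mathcal L_m(s)$. (i) If $s$ is odd, then every maximizer satisfies $t=\frac{s-1}2$ and one of (1) $a_{(t-1)m+1}=\dots=a_{tm}=1$; (2) $a_{(t-1)m+1}=\dots=a_{tm-1}=2$ and $a_{tm}=1$. (ii) If $s\ge4$ is even, then every maximizer satisfies $t=\frac s2$, $a_{tm}=0$ and one of (1) $a_{(t-1)m}=a_{(t-1)m+1}=\dots=a_{tm-1}=1$; (2) $a_{(t-1)m}=2$ and $a_{(t-1)m+1}=\dots=a_{tm-1}=1$. In (i) and in (ii), each of the two cases holds for exactly one maximizer; so there are exactly two maximizers. (iii) If $s=2$, then there is exactly one maximizer, and it satisfies $t=1$, $a_1=\dots=a_{m-1}=1$ and $a_m=0$. -/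

import Mathlib

namespace GenBeta

/-- The `N`-pyramid with base `[a, b]`: the positions `(i, j)` (row `i`, column `j`) of the
`N`-abacus with `a + i ≤ j ≤ b - i`. The position `(i, j)` stands for the integer `N * i + j`. -/
def pyramid (N a b : ℕ) : Set ℕ :=
  {x | ∃ i j : ℕ, j < N ∧ a + i ≤ j ∧ j + i ≤ b ∧ x = N * i + j}

/-- The set `𝓛_m(s)`: the union of the `ms`-pyramids `P_k` with base `[(k-1)s+1, ks-1]`
for `1 ≤ k ≤ m-1` and of the `ms`-pyramid `P_m` with base `[(m-1)s+1, ms-2]`. -/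
def bigL (m s : ℕ) : Set ℕ :=
  {x | ∃ k : ℕ, 1 ≤ k ∧ k ≤ m - 1 ∧ x ∈ pyramid (m * s) ((k - 1) * s + 1) (k * s - 1)} ∪
    pyramid (m * s) ((m - 1) * s + 1) (m * s - 2)

/-- The size-counting function `f(S) = ∑_{x ∈ S} x - |S|(|S|-1)/2`. -/
def sizeCount (S : Finset ℕ) : ℚ :=
  ∑ x ∈ S, (x : ℚ) - (S.card : ℚ) * ((S.card : ℚ) - 1) / 2

/-- `t(S) = min {i ≥ 1 : S ⊆ [0, ims - 1]}`. -/
noncomputable def numRows (m s : ℕ) (S : Finset ℕ) : ℕ :=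
  sInf {i : ℕ | 1 ≤ i ∧ ∀ x ∈ S, x < i * (m * s)}

/-- `𝓑_i(S) = S ∩ [(i-1)s, is-1]`, for `i ≥ 1`. -/
def block (s : ℕ) (S : Finset ℕ) (i : ℕ) : Finset ℕ :=
  S.filter fun x => (i - 1) * s ≤ x ∧ x < i * s

/-- `a_i(S) = |𝓑_i(S)|`. -/
def a (s : ℕ) (S : Finset ℕ) (i : ℕ) : ℕ :=
  (block s S i).card

/-- `n_i(S)`, the largest residue mod `s` of an element of `𝓑_i(S)`; it is `0` if
`𝓑_i(S)` is empty. -/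
def n (s : ℕ) (S : Finset ℕ) (i : ℕ) : ℕ :=
  (block s S i).sup fun x => x % s

/-- Generalized-β-sets. The number `⌈(s-1)/2⌉` is written out as a natural-number ceiling, and
the sixth condition, which concerns `a_{(t-1)m}`, is void when `t = 1`. -/
structure IsGenBetaSet (m s : ℕ) (S : Finset ℕ) : Prop where
  nonempty : S.Nonempty
  subset : (S : Set ℕ) ⊆ bigL m s
  cond1 : ∀ i, 1 ≤ i → i < ⌈((s : ℚ) - 1) / 2⌉₊ * m → a s S i = 0 → a s S (i + 1) = 0
  cond2 : ∀ i, 1 ≤ i → i < numRows m s S * m → ¬ m ∣ i → a s S (i + 1) ≤ a s S i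
  cond3 : ∀ i, 1 ≤ i → i ≤ (numRows m s S - 1) * m → 0 < a s S (i + m) →
    a s S (i + m) + 2 ≤ a s S i
  cond4 : ∀ i, 1 ≤ i → i < numRows m s S * m → ¬ m ∣ i → 0 < a s S (i + 1) →
    n s S (i + 1) ≤ n s S i
  cond5 : ∀ i, 1 ≤ i → i < numRows m s S * m → ¬ m ∣ i → a s S i = a s S (i + 1) →
    0 < a s S (i + 1) → n s S i = n s S (i + 1)
  cond6 : 2 ≤ numRows m s S →
    a s S ((numRows m s S - 1) * m + 1) ≤ a s S ((numRows m s S - 1) * m)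

/-- `S` is a generalized-β-set that maximizes `f` among all generalized-β-sets in `𝓛_m(s)`. -/
def IsMaximizer (m s : ℕ) (S : Finset ℕ) : Prop :=
  IsGenBetaSet m s S ∧ ∀ S' : Finset ℕ, IsGenBetaSet m s S' → sizeCount S' ≤ sizeCount S

/-- `t = (s-1)/2` and `a_{(t-1)m+1} = ⋯ = a_{tm} = 1`. -/
def OddCase1 (m s : ℕ) (S : Finset ℕ) : Prop :=
  numRows m s S = (s - 1) / 2 ∧
    ∀ i, (numRows m s S - 1) * m + 1 ≤ i → i ≤ numRows m s S * m → a s S i = 1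

/-- `t = (s-1)/2`, `a_{(t-1)m+1} = ⋯ = a_{tm-1} = 2` and `a_{tm} = 1`. -/
def OddCase2 (m s : ℕ) (S : Finset ℕ) : Prop :=
  numRows m s S = (s - 1) / 2 ∧
    (∀ i, (numRows m s S - 1) * m + 1 ≤ i → i ≤ numRows m s S * m - 1 → a s S i = 2) ∧
    a s S (numRows m s S * m) = 1

/-- `t = s/2`, `a_{(t-1)m+1} = ⋯ = a_{tm-1} = 1` and `a_{tm} = 0`. -/
def EvenLastRow (m s : ℕ) (S : Finset ℕ) : Prop :=
  numRows m s S = s / 2 ∧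
    (∀ i, (numRows m s S - 1) * m + 1 ≤ i → i ≤ numRows m s S * m - 1 → a s S i = 1) ∧
    a s S (numRows m s S * m) = 0

/-- `t = s/2`, `a_{(t-1)m} = ⋯ = a_{tm-1} = 1` and `a_{tm} = 0`. -/
def EvenCase1 (m s : ℕ) (S : Finset ℕ) : Prop :=
  EvenLastRow m s S ∧ a s S ((numRows m s S - 1) * m) = 1

/-- `t = s/2`, `a_{(t-1)m} = 2`, `a_{(t-1)m+1} = ⋯ = a_{tm-1} = 1` and `a_{tm} = 0`. -/
def EvenCase2 (m s : ℕ) (S : Finset ℕ) : Prop :=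
  EvenLastRow m s S ∧ a s S ((numRows m s S - 1) * m) = 2

end GenBeta

namespace GenBeta

open Finset

/-! ### One-dimensional sums -/

/-! Arrange the blocks of `S` in an array: the block in row `r` and column `k` is `𝓑_i` with `i =
r*m + k + 1`. The pyramids leave it the residues `r+1, …, s-r-1`, without the largest one in the
last column. For given block sizes, pushing every block to the top of its window maximizes the sum,
so `2f` is `arrayGain` of the sizes minus nonnegative block defects (`twiceSize_eq`). By condition 1
the nonempty blocks are `R` whole rows followed by `p` blocks of the next row (`exists_shape`). By
conditions 2 and 3 sizes decrease weakly along rows and by at least two down columns. Hence the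
deviations `e` from a staircase of slope two increase weakly in both directions, as long as the
blocks are nonempty.

In terms of `e`, `arrayGain` is a constant plus terms in `∑ e`, `(∑ e)²`, `∑ e²` and the last
column, minus large multiples of the centered moments `∑ (2r-(G-1)) e` and `∑ (2k-(w-1)) e`. These
moments are nonnegative by Chebyshev's inequality and measure how far `e` is from constant. The only
reward for a non-constant `0`-`1` deviation is a term `D(N-D)`, with `D` the sum of the deviations
and `N` the number of positions. The moments pay for it (`mul_le_sum_centered`,
`mul_le_sum_centered_grid`), so equality leaves just two constant deviations, `0` and `1`. These are
the two maximizers.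

Let `T = s/2`, rounded down. For even `s` the last block of row `T-1` has an empty window, and the
best shape is `R = T-1`, `p = m-1`. All columns but the last are then forced to be full, and the
last one is short by a constant `0` or `1` (`Shape.le_evenMax`). For odd `s` the best shape is `R =
T`: every block outside the last column is full or one short. A short block ties with the last block
of its row, so condition 5 makes it give up its top residue (`lt_of_tie`). With this loss included,
either none or all of these blocks are short (`Shape.le_oddMax`).

Most other shapes lose already after relaxing to real sizes (`Shape.arrayGain_le`). Two families
with `R = T-1` are too close for that and use integrality: an empty last row for even `s`, and a
partly filled last row for odd `s`. -/

theorem le_of_antitone_range {z : ℕ → ℤ} {G : ℕ} (hz : ∀ i, i + 1 < G → z (i + 1) ≤ z i)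
    {i j : ℕ} (hij : i ≤ j) (hj : j < G) : z j ≤ z i := by
  induction j, hij using Nat.le_induction with
  | base => exact le_rfl
  | succ j _ ih => exact (hz j hj).trans (ih (by omega))

/-- The centered sum equals `∑_{i<j} (z j - z i)`, so a new last index `G` contributes exactly its
differences with the earlier entries. The inductions below rest on this. -/
theorem sum_centered_succ (z : ℕ → ℤ) (G : ℕ) :
    ∑ i ∈ range (G + 1), (2 * (i : ℤ) - ((G + 1 : ℕ) - 1)) * z i =
      ∑ i ∈ range G, (2 * (i : ℤ) - (G - 1)) * z i + ∑ i ∈ range G, (z G - z i) := by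
  rw [sum_range_succ, sum_sub_distrib, sum_const, card_range, nsmul_eq_mul]
  have : ∑ i ∈ range G, (2 * (i : ℤ) - ((G + 1 : ℕ) - 1)) * z i =
      ∑ i ∈ range G, (2 * (i : ℤ) - (G - 1)) * z i - ∑ i ∈ range G, z i := by
    rw [← sum_sub_distrib]
    refine sum_congr rfl fun i _ => ?_
    push_cast; ring
  rw [this]; push_cast; ring

/-- Chebyshev's sum inequality against the centered weights `2i - (G-1)`. -/
theorem sum_centered_nonpos {z : ℕ → ℤ} {G : ℕ} (hz : ∀ i, i + 1 < G → z (i + 1) ≤ z i) :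
    ∑ i ∈ range G, (2 * (i : ℤ) - (G - 1)) * z i ≤ 0 := by
  induction G with
  | zero => simp
  | succ G ih =>
    rw [sum_centered_succ]
    have h1 := ih fun i hi => hz i (by omega)
    have h2 : ∑ i ∈ range G, (z G - z i) ≤ 0 := sum_nonpos fun i hi => by
      have := le_of_antitone_range hz (mem_range.1 hi).le (Nat.lt_succ_self G)
      linarith
    linarith

theorem sum_centered_nonneg {z : ℕ → ℤ} {G : ℕ} (hz : ∀ i, i + 1 < G → z i ≤ z (i + 1)) :
    0 ≤ ∑ i ∈ range G, (2 * (i : ℤ) - (G - 1)) * z i := by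
  have := sum_centered_nonpos (z := fun i => -z i) (G := G) fun i hi => by
    have := hz i hi
    simpa using this
  simpa using this

theorem sum_two_mul_sub (G : ℕ) (a : ℤ) :
    ∑ i ∈ range G, (2 * (i : ℤ) - a) = G * (G - 1) - a * G := by
  induction G with
  | zero => simp
  | succ G ih => rw [sum_range_succ, ih]; push_cast; ring

theorem sum_centered (G : ℕ) : ∑ i ∈ range G, (2 * (i : ℤ) - (G - 1)) = 0 := by
  rw [sum_two_mul_sub]; ring

theorem three_mul_sum_sq (G : ℕ) (a : ℤ) :
    3 * ∑ i ∈ range G, (2 * (i : ℤ) - a) ^ 2 =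
      2 * G * (G - 1) * (2 * G - 1) - 6 * a * (G * (G - 1)) + 3 * G * a ^ 2 := by
  induction G with
  | zero => simp
  | succ G ih => rw [sum_range_succ, mul_add, ih]; push_cast; ring

theorem three_mul_sum_centered_sq (G : ℕ) :
    3 * ∑ i ∈ range G, (2 * (i : ℤ) - (G - 1)) ^ 2 = (G : ℤ) * ((G : ℤ) ^ 2 - 1) := by
  rw [three_mul_sum_sq]; ring

/-- A nondecreasing sequence of natural numbers with sum `D` is at least as spread out as the
indicator of its last `D` positions. -/
theorem mul_le_sum_centered {d : ℕ → ℤ} {G : ℕ} (h0 : ∀ i < G, 0 ≤ d i)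
    (hd : ∀ i, i + 1 < G → d i ≤ d (i + 1)) :
    (∑ i ∈ range G, d i) * (G - ∑ i ∈ range G, d i) ≤
      ∑ i ∈ range G, (2 * (i : ℤ) - (G - 1)) * d i := by
  induction G generalizing d with
  | zero => simp
  | succ G ih =>
    rcases (h0 0 (Nat.succ_pos G)).eq_or_lt with h | h
    -- A zero first entry can be dropped: with `D = ∑ d`, the weights of the other entries shift by
    -- one, which adds `D`, and `D (G + 1 - D)` exceeds `D (G - D)` by `D` as well.
    · have h1 := ih (d := fun i => d (i + 1)) (fun i hi => h0 _ (by omega))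
        (fun i hi => hd _ (by omega))
      rw [sum_range_succ', sum_range_succ', ← h]
      have h2 : ∑ i ∈ range G, (2 * ((i + 1 : ℕ) : ℤ) - ((G + 1 : ℕ) - 1)) * d (i + 1) =
          ∑ i ∈ range G, (2 * (i : ℤ) - (G - 1)) * d (i + 1) + ∑ i ∈ range G, d (i + 1) := by
        rw [← sum_add_distrib]
        refine sum_congr rfl fun i _ => ?_
        push_cast; ring
      rw [h2]
      push_cast
      nlinarith
    -- Otherwise every entry is at least one, so the sum is at least `G + 1` and the left side is
    -- nonpositive.
    · have h1 : ∀ i < G + 1, 1 ≤ d i := fun i hi => by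
        have := le_of_antitone_range (z := fun i => -d i) (G := G + 1)
          (fun i hi => by simpa using hd i hi) (Nat.zero_le i) hi
        linarith [Int.add_one_le_of_lt h]
      have h2 : ((G + 1 : ℕ) : ℤ) ≤ ∑ i ∈ range (G + 1), d i := by
        have := sum_le_sum (s := range (G + 1)) (f := fun _ => (1 : ℤ)) (g := d)
          fun i hi => h1 i (mem_range.1 hi)
        simpa using this
      have h3 := sum_centered_nonneg hd
      nlinarith

/-- A nondecreasing integer sequence that is not constant has a large centered sum. -/
theorem le_sum_centered_of_lt {d : ℕ → ℤ} {G j : ℕ} (hd : ∀ i, i + 1 < G → d i ≤ d (i + 1))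
    (hj : j + 1 < G) (hlt : d j < d (j + 1)) :
    (G : ℤ) - 1 ≤ ∑ i ∈ range G, (2 * (i : ℤ) - (G - 1)) * d i := by
  -- Subtracting the unit step at the jump keeps the sequence nondecreasing, and the step alone has
  -- centered sum at least `(G-1-j)(j+1) ≥ G-1`.
  set f : ℕ → ℤ := fun i => if j < i then 1 else 0 with hf
  have h1 := sum_centered_nonneg (z := fun i => d i - f i) (G := G) (fun i hi => by
    have := hd i hi
    simp only [hf]
    rcases lt_trichotomy i j with h | h | h
    · rw [if_neg (by omega), if_neg (by omega)]; omega
    · subst h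
      rw [if_neg (by omega), if_pos (by omega)]; omega
    · rw [if_pos (by omega), if_pos (by omega)]; omega)
  have h2 := mul_le_sum_centered (d := f) (G := G) (fun i _ => by simp only [hf]; split_ifs <;> simp)
    (fun i hi => by simp only [hf]; split_ifs <;> omega)
  have h3 : ∑ i ∈ range G, f i = G - 1 - j := by
    obtain ⟨l, rfl⟩ : ∃ l, G = j + 1 + l := ⟨G - (j + 1), by omega⟩
    rw [sum_range_add, sum_eq_zero (fun i hi => by
        simp only [hf]; rw [if_neg]; have := mem_range.1 hi; omega),
      sum_congr rfl (g := fun _ => (1 : ℤ)) (fun i _ => by simp only [hf]; rw [if_pos]; omega)]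
    simp
    ring
  rw [h3] at h2
  simp only [mul_sub, sum_sub_distrib] at h1 h2 ⊢
  have h4 : (0 : ℤ) ≤ j := by positivity
  have h5 : (j : ℤ) + 2 ≤ G := by exact_mod_cast hj
  nlinarith

/-- The left side is `∑_{i<j} (X j - X i)²`, and each difference lies in `[0, w]`, so its square is
at most `w` times itself. -/
theorem sum_sq_le_centered {X : ℕ → ℤ} {G : ℕ} {w : ℤ} (h0 : ∀ i < G, 0 ≤ X i)
    (hw : ∀ i < G, X i ≤ w) (hX : ∀ i, i + 1 < G → X i ≤ X (i + 1)) :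
    G * ∑ i ∈ range G, X i ^ 2 - (∑ i ∈ range G, X i) ^ 2 ≤
      w * ∑ i ∈ range G, (2 * (i : ℤ) - (G - 1)) * X i := by
  induction G with
  | zero => simp
  | succ G ih =>
    have h1 := ih (fun i hi => h0 i (by omega)) (fun i hi => hw i (by omega))
      (fun i hi => hX i (by omega))
    have h2 : ∑ i ∈ range G, (X G - X i) ^ 2 ≤ w * ∑ i ∈ range G, (X G - X i) := by
      rw [mul_sum]
      refine sum_le_sum fun i hi => ?_
      have hi' := mem_range.1 hi
      have a1 := le_of_antitone_range (z := fun i => -X i) (G := G + 1)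
          (fun i hi => by simpa using hX i hi) hi'.le (Nat.lt_succ_self G)
      have a2 := h0 i (by omega)
      have a3 := hw G (by omega)
      nlinarith
    have h3 : ∑ i ∈ range G, (X G - X i) ^ 2 =
        G * X G ^ 2 - 2 * X G * ∑ i ∈ range G, X i + ∑ i ∈ range G, X i ^ 2 := by
      have : ∀ i ∈ range G, (X G - X i) ^ 2 = X G ^ 2 - 2 * X G * X i + X i ^ 2 :=
        fun i _ => by ring
      rw [sum_congr rfl this, sum_add_distrib, sum_sub_distrib, ← mul_sum]
      simp
    rw [sum_centered_succ, mul_add]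
    rw [sum_range_succ, sum_range_succ]
    push_cast
    nlinarith

/-! ### Two-dimensional sums -/

/-- The isoperimetric inequality for a `0`-`1`-array that is nondecreasing in both indices. -/
theorem mul_le_sum_centered_grid {e : ℕ → ℕ → ℤ} {G w : ℕ}
    (h0 : ∀ r < G, ∀ k < w, 0 ≤ e r k) (h1 : ∀ r < G, ∀ k < w, e r k ≤ 1)
    (hr : ∀ r, r + 1 < G → ∀ k < w, e r k ≤ e (r + 1) k)
    (hk : ∀ r < G, ∀ k, k + 1 < w → e r k ≤ e r (k + 1)) :
    (∑ r ∈ range G, ∑ k ∈ range w, e r k) * (G * w - ∑ r ∈ range G, ∑ k ∈ range w, e r k) ≤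
      w * ∑ r ∈ range G, ∑ k ∈ range w, (2 * (r : ℤ) - (G - 1)) * e r k +
      G * ∑ r ∈ range G, ∑ k ∈ range w, (2 * (k : ℤ) - (w - 1)) * e r k := by
  set X : ℕ → ℤ := fun r => ∑ k ∈ range w, e r k with hX
  have a1 : ∀ r < G, 0 ≤ X r := fun r hr' =>
    sum_nonneg fun k hk' => h0 r hr' k (mem_range.1 hk')
  have a2 : ∀ r < G, X r ≤ w := fun r hr' => by
    have := sum_le_sum (s := range w) (f := e r) (g := fun _ => (1 : ℤ))
      fun k hk' => h1 r hr' k (mem_range.1 hk')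
    simpa using this
  have a3 : ∀ r, r + 1 < G → X r ≤ X (r + 1) := fun r hr' =>
    sum_le_sum fun k hk' => hr r hr' k (mem_range.1 hk')
  -- With `N` the total and `X r` the row sums, `N(Gw - N) = (G ∑ X² - N²) + G ∑ X(w - X)`. The row
  -- moment bounds the first summand, the column moment the second.
  have b1 := sum_sq_le_centered a1 a2 a3
  have b2 : ∑ r ∈ range G, X r * (w - X r) ≤
      ∑ r ∈ range G, ∑ k ∈ range w, (2 * (k : ℤ) - (w - 1)) * e r k :=
    sum_le_sum fun r hr' => mul_le_sum_centered (h0 r (mem_range.1 hr')) (hk r (mem_range.1 hr'))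
  have b3 : ∑ r ∈ range G, X r * (w - X r) =
      w * ∑ r ∈ range G, X r - ∑ r ∈ range G, X r ^ 2 := by
    rw [mul_sum, ← sum_sub_distrib]
    exact sum_congr rfl fun r _ => by ring
  have b4 : ∑ r ∈ range G, ∑ k ∈ range w, (2 * (r : ℤ) - (G - 1)) * e r k =
      ∑ r ∈ range G, (2 * (r : ℤ) - (G - 1)) * X r :=
    sum_congr rfl fun r _ => by rw [hX, mul_sum]
  rw [b4]
  have hG : (0 : ℤ) ≤ G := by positivity
  nlinarith

theorem sum_centered_rows_nonneg {e : ℕ → ℕ → ℤ} {G w : ℕ}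
    (hr : ∀ r, r + 1 < G → ∀ k < w, e r k ≤ e (r + 1) k) :
    0 ≤ ∑ r ∈ range G, ∑ k ∈ range w, (2 * (r : ℤ) - (G - 1)) * e r k := by
  rw [sum_comm]
  exact sum_nonneg fun k hk => sum_centered_nonneg fun r hr' => hr r hr' k (mem_range.1 hk)

theorem sum_centered_cols_nonneg {e : ℕ → ℕ → ℤ} {G w : ℕ}
    (hk : ∀ r < G, ∀ k, k + 1 < w → e r k ≤ e r (k + 1)) :
    0 ≤ ∑ r ∈ range G, ∑ k ∈ range w, (2 * (k : ℤ) - (w - 1)) * e r k :=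
  sum_nonneg fun r hr => sum_centered_nonneg (hk r (mem_range.1 hr))

/-- The contribution of the block in row `r` and column `k` of the abacus, if it holds its `x`
largest admissible elements. -/
def blockGain (m s r k : ℕ) (x : ℤ) : ℤ :=
  2 * x * ((r * m + k) * s + s - 1 - r) - x ^ 2 + x

/-- Evaluation of the total contribution of a rectangle of blocks in terms of the deviations `e`
from the staircase `Y - (2r - (G - 1))`. -/
theorem three_mul_sum_blockGain (m s G w k₀ : ℕ) (Y : ℤ) (e : ℕ → ℕ → ℤ) :
    3 * ∑ r ∈ range G, ∑ k ∈ range w,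
        blockGain m s r (k₀ + k) (Y - e r k - (2 * (r : ℤ) - (G - 1))) =
      3 * (-(m * s + 1) * ∑ r ∈ range G, ∑ k ∈ range w, (2 * (r : ℤ) - (G - 1)) * e r k
        - s * ∑ r ∈ range G, ∑ k ∈ range w, (2 * (k : ℤ) - (w - 1)) * e r k
        + ((m * s - 1) * (G - 1) + s * (w - 1) + 2 * k₀ * s + 2 * s - 1) *
          (G * w * Y - ∑ r ∈ range G, ∑ k ∈ range w, e r k)
        - (G * w * Y ^ 2 - 2 * Y * ∑ r ∈ range G, ∑ k ∈ range w, e r k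
          + ∑ r ∈ range G, ∑ k ∈ range w, e r k ^ 2))
        - m * s * w * (G * (G ^ 2 - 1)) := by
  set κ : ℤ := (m * s - 1) * (G - 1) + s * (w - 1) + 2 * k₀ * s + 2 * s - 1 with hκ
  -- In the part free of `e`, single centered weights and their mixed products sum to zero; only the
  -- squared row weights survive and give `G(G²-1)`.
  have key : ∀ r ∈ range G, ∀ k ∈ range w,
      blockGain m s r (k₀ + k) (Y - e r k - (2 * (r : ℤ) - (G - 1))) =
        -(m * s + 1) * ((2 * (r : ℤ) - (G - 1)) * e r k)
        - s * ((2 * (k : ℤ) - (w - 1)) * e r k)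
        + (2 * Y - κ) * e r k - e r k ^ 2
        + ((κ * Y - Y ^ 2) + (s * Y) * (2 * (k : ℤ) - (w - 1))
        + ((m * s + 1) * Y - κ) * (2 * (r : ℤ) - (G - 1))
        - s * ((2 * (r : ℤ) - (G - 1)) * (2 * (k : ℤ) - (w - 1)))
        - m * s * (2 * (r : ℤ) - (G - 1)) ^ 2) := by
    intro r _ k _
    rw [blockGain, hκ]; push_cast; ring
  rw [sum_congr rfl fun r hr => sum_congr rfl (key r hr)]
  simp only [sum_add_distrib, sum_sub_distrib, ← mul_sum, sum_const, card_range, nsmul_eq_mul,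
    ← sum_mul]
  have h := three_mul_sum_centered_sq G
  have hG := sum_centered G
  have hw := sum_centered w
  simp only [sum_sub_distrib, ← mul_sum, sum_const, card_range, nsmul_eq_mul] at hG hw
  linear_combination (-(m * s * w : ℤ)) * h + 3 * (s * Y * G) * hw +
    3 * (((m * s + 1) * Y - κ) * w) * hG
    - 3 * s * (2 * ∑ i ∈ range w, (i : ℤ) - (w * w - w * 1)) * hG

/-- The size of a set whose blocks hold `b r k` largest admissible elements, doubled. -/
def arrayGain (m s G : ℕ) (b : ℕ → ℕ → ℤ) : ℤ :=
  ∑ r ∈ range G, ∑ k ∈ range m, blockGain m s r k (b r k) - 2 * ∑ r ∈ range G, b r (m - 1)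
    - (∑ r ∈ range G, ∑ k ∈ range m, b r k) ^ 2 + ∑ r ∈ range G, ∑ k ∈ range m, b r k

end GenBeta

/-! ### Shapes of block arrays and the relaxed upper bound -/

namespace GenBeta

open Finset

/-- An array of block sizes with `R` full rows of nonempty blocks, followed by a row in which
exactly the first `p` blocks are nonempty. -/
structure Shape (m s T R p : ℕ) (b : ℕ → ℕ → ℤ) : Prop where
  p_lt : p < m
  size_pos : 0 < R * m + p
  size_le : R * m + p ≤ T * m
  pos : ∀ r k, r < R → k < m → 0 < b r k
  pos_last : ∀ k, k < p → 0 < b R k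
  zero_last : ∀ k, p ≤ k → k < m → b R k = 0
  zero : ∀ r k, R < r → k < m → b r k = 0
  row : ∀ r k, k + 1 < m → b r (k + 1) ≤ b r k
  col : ∀ r k, k < m → 0 < b (r + 1) k → b (r + 1) k + 2 ≤ b r k
  cap : ∀ r k, r < T → k + 1 < m → b r k ≤ s - 1 - 2 * r
  cap_last : ∀ r, r < T → b r (m - 1) ≤ s - 2 - 2 * r

variable {m s T R p : ℕ} {b : ℕ → ℕ → ℤ}

theorem Shape.R_le (h : Shape m s T R p b) : R ≤ T := by
  have h1 := h.size_le
  have h2 := h.p_lt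
  by_contra hc
  have : (T + 1) * m ≤ R * m := Nat.mul_le_mul_right _ (by omega)
  nlinarith

theorem Shape.R_lt (h : Shape m s T R p b) (hp : 0 < p) : R < T := by
  have h1 := h.size_le
  by_contra hc
  have : T * m ≤ R * m := Nat.mul_le_mul_right _ (by omega)
  omega

theorem sum_range_eq_of_zero {f : ℕ → ℤ} {a c : ℕ} (hac : a ≤ c) (h : ∀ i, a ≤ i → f i = 0) :
    ∑ i ∈ range c, f i = ∑ i ∈ range a, f i := by
  refine (sum_subset (range_subset_range.2 hac) fun i _ hi => h i ?_).symm
  simpa using hi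

/-- A sum over the nonempty blocks splits into two rectangles. -/
theorem Shape.sum_eq (h : Shape m s T R p b) {f : ℕ → ℕ → ℤ}
    (hf : ∀ r k, k < m → b r k = 0 → f r k = 0) :
    ∑ r ∈ range T, ∑ k ∈ range m, f r k =
      ∑ r ∈ range (R + 1), ∑ k ∈ range p, f r k +
        ∑ r ∈ range R, ∑ k ∈ range (m - p), f r (p + k) := by
  have hm : m = p + (m - p) := by have := h.p_lt; omega
  have h1 : ∀ r, ∑ k ∈ range m, f r k =
      ∑ k ∈ range p, f r k + ∑ k ∈ range (m - p), f r (p + k) := fun r => by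
    conv_lhs => rw [hm]
    exact sum_range_add _ _ _
  simp only [h1, sum_add_distrib]
  congr 1
  · rcases Nat.eq_zero_or_pos p with rfl | hp
    · simp
    · refine sum_range_eq_of_zero (h.R_lt hp) fun r hr => sum_eq_zero fun k hk => ?_
      have hk' : k < m := (mem_range.1 hk).trans h.p_lt
      exact hf r k hk' (h.zero r k hr hk')
  · refine sum_range_eq_of_zero h.R_le fun r hr => sum_eq_zero fun k hk => ?_
    have hk' : p + k < m := by have := mem_range.1 hk; omega
    refine hf r _ hk' ?_
    rcases hr.eq_or_lt with rfl | hr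
    · exact h.zero_last _ (by omega) hk'
    · exact h.zero r _ hr hk'

theorem Shape.sum_last_eq (h : Shape m s T R p b) :
    ∑ r ∈ range T, b r (m - 1) = ∑ r ∈ range R, b r (m - 1) := by
  have := h.p_lt
  refine sum_range_eq_of_zero h.R_le fun r hr => ?_
  rcases hr.eq_or_lt with rfl | hr
  · exact h.zero_last _ (by omega) (by omega)
  · exact h.zero r _ hr (by omega)

theorem Shape.col_of_pos (h : Shape m s T R p b) {r k : ℕ} (hr : r < R) (hk : k < m) 
    (hp : r + 1 = R → k < p) : b (r + 1) k + 2 ≤ b r k := by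
  refine h.col r k hk ?_
  rcases Nat.lt_or_ge (r + 1) R with h1 | h1
  · exact h.pos _ _ h1 hk
  · obtain rfl : r + 1 = R := by omega
    exact h.pos_last k (hp rfl)

/-- The upper bound for the size obtained by allowing real block sizes. -/
theorem Shape.arrayGain_le (h : Shape m s T R p b) :
    12 * arrayGain m s T b ≤
      3 * (R * m + p) * (R * m + p + 1) * s ^ 2 - 6 * (R * m + p) * s * R +
        6 * (m - p - 2) * R * s - 4 * m * s * R * (m * (R ^ 2 - 1) + 3 * p * (R + 1)) +
        3 * R ^ 2 + 3 * (m - p) * R := by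
  obtain ⟨u, hu⟩ : ∃ u, m = p + (u + 1) := ⟨m - p - 1, by have := h.p_lt; omega⟩
  have hmp : m - p = u + 1 := by omega
  -- The first `p` columns have height `R + 1`, the others height `R`, so each rectangle gets its
  -- own centered staircase (with `Y = 0`).
  set e₁ : ℕ → ℕ → ℤ := fun r k => -(b r k + (2 * (r : ℤ) - ((R + 1 : ℕ) - 1))) with he₁
  set e₂ : ℕ → ℕ → ℤ := fun r k => -(b r (p + k) + (2 * (r : ℤ) - (R - 1))) with he₂
  have g1 := three_mul_sum_blockGain m s (R + 1) p 0 0 e₁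
  have g2 := three_mul_sum_blockGain m s R (u + 1) p 0 e₂
  have a1 : 0 ≤ ∑ r ∈ range (R + 1), ∑ k ∈ range p,
      (2 * (r : ℤ) - ((R + 1 : ℕ) - 1)) * e₁ r k :=
    sum_centered_rows_nonneg fun r hr k hk => by
      have := h.col_of_pos (r := r) (k := k) (by omega) (hk.trans h.p_lt) fun _ => hk
      simp only [he₁]; push_cast; linarith
  have a2 : 0 ≤ ∑ r ∈ range (R + 1), ∑ k ∈ range p, (2 * (k : ℤ) - (p - 1)) * e₁ r k :=
    sum_centered_cols_nonneg fun r _ k hk => by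
      have := h.row r k (hk.trans h.p_lt)
      simp only [he₁]; linarith
  have a3 : 0 ≤ ∑ r ∈ range R, ∑ k ∈ range (u + 1), (2 * (r : ℤ) - (R - 1)) * e₂ r k :=
    sum_centered_rows_nonneg fun r hr k hk => by
      have := h.col_of_pos (r := r) (k := p + k) (by omega) (by omega) (by omega)
      simp only [he₂]; push_cast; linarith
  have a4 : 0 ≤ ∑ r ∈ range R, ∑ k ∈ range (u + 1),
      (2 * (k : ℤ) - ((u + 1 : ℕ) - 1)) * e₂ r k :=
    sum_centered_cols_nonneg fun r _ k hk => by
      have := h.row r (p + k) (by omega)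
      simp only [he₂, ← add_assoc]; linarith
  have hb1 : ∀ r k, (0 : ℤ) - e₁ r k - (2 * (r : ℤ) - ((R + 1 : ℕ) - 1)) = b r k := fun r k => by
    simp only [he₁]; ring
  have hb2 : ∀ r k, (0 : ℤ) - e₂ r k - (2 * (r : ℤ) - (R - 1)) = b r (p + k) := fun r k => by
    simp only [he₂]; ring
  have hs := h.sum_eq (f := fun r k => blockGain m s r k (b r k)) fun r k _ hb => by
    simp [blockGain, hb]
  have hn := h.sum_eq (f := b) fun r k _ hb => hb
  rw [hmp] at hs hn
  have hn1 : ∑ r ∈ range (R + 1), ∑ k ∈ range p, b r k =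
      -∑ r ∈ range (R + 1), ∑ k ∈ range p, e₁ r k := by
    have := sum_centered (R + 1)
    simp only [he₁, sum_neg_distrib, sum_add_distrib, neg_neg, sum_const, card_range,
      ← smul_sum, this]
    simp
  have hn2 : ∑ r ∈ range R, ∑ k ∈ range (u + 1), b r (p + k) =
      -∑ r ∈ range R, ∑ k ∈ range (u + 1), e₂ r k := by
    have := sum_centered R
    simp only [he₂, sum_neg_distrib, sum_add_distrib, neg_neg, sum_const, card_range,
      ← smul_sum, this]
    simp
  have hl : ∑ r ∈ range T, b r (m - 1) = -∑ r ∈ range R, e₂ r u := by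
    have := sum_centered R
    have hmu : m - 1 = p + u := by omega
    rw [h.sum_last_eq, hmu]
    simp only [he₂, sum_neg_distrib, sum_add_distrib, neg_neg, this]
    simp
  -- The real relaxation: once the moments are discarded, the quadratic terms are completed to
  -- squares, each bounded below by zero separately. In the last column `(y+1)² - 4y = (y-1)²` with
  -- `y = 2e + s` absorbs the shorter window.
  have q1 : 0 ≤ ∑ r ∈ range (R + 1), ∑ k ∈ range p, (2 * e₁ r k + s) ^ 2 :=
    sum_nonneg fun _ _ => sum_nonneg fun _ _ => sq_nonneg _
  have q2 : 0 ≤ ∑ r ∈ range R,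
      (∑ k ∈ range (u + 1), (2 * e₂ r k + s + 1) ^ 2 - 4 * (2 * e₂ r u + s)) :=
    sum_nonneg fun r _ => by
      rw [sum_range_succ]
      have : 0 ≤ ∑ k ∈ range u, (2 * e₂ r k + s + 1) ^ 2 := sum_nonneg fun _ _ => sq_nonneg _
      nlinarith [sq_nonneg (2 * e₂ r u + s - 1)]
  have x1 : ∀ r k, (2 * e₁ r k + s) ^ 2 = 4 * e₁ r k ^ 2 + 4 * s * e₁ r k + s ^ 2 :=
    fun r k => by ring
  have x2 : ∀ r k, (2 * e₂ r k + s + 1) ^ 2 =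
      4 * e₂ r k ^ 2 + 4 * (s + 1) * e₂ r k + (s + 1) ^ 2 := fun r k => by ring
  simp only [x1, sum_add_distrib, ← mul_sum, sum_const, card_range, nsmul_eq_mul] at q1
  simp only [x2, sum_add_distrib, sum_sub_distrib, ← mul_sum, sum_const, card_range,
    nsmul_eq_mul] at q2
  simp only [hb1, zero_add] at g1
  simp only [hb2] at g2
  rw [arrayGain, hs, hn, hn1, hn2, hl]
  have hmZ : (m : ℤ) = p + (u + 1) := by exact_mod_cast hu
  generalize (∑ r ∈ range (R + 1), ∑ k ∈ range p, e₁ r k) = E₁ at *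
  generalize (∑ r ∈ range R, ∑ k ∈ range (u + 1), e₂ r k) = E₂ at *
  generalize (∑ r ∈ range R, e₂ r u) = L at *
  generalize (∑ r ∈ range (R + 1), ∑ k ∈ range p, e₁ r k ^ 2) = Q₁ at *
  generalize (∑ r ∈ range R, ∑ k ∈ range (u + 1), e₂ r k ^ 2) = Q₂ at *
  generalize (∑ r ∈ range (R + 1), ∑ k ∈ range p,
      (2 * (r : ℤ) - ((R + 1 : ℕ) - 1)) * e₁ r k) = A₁ at *
  generalize (∑ r ∈ range (R + 1), ∑ k ∈ range p, (2 * (k : ℤ) - (p - 1)) * e₁ r k) = A₂ at *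
  generalize (∑ r ∈ range R, ∑ k ∈ range (u + 1), (2 * (r : ℤ) - (R - 1)) * e₂ r k) = A₃ at *
  generalize (∑ r ∈ range R, ∑ k ∈ range (u + 1),
      (2 * (k : ℤ) - ((u + 1 : ℕ) - 1)) * e₂ r k) = A₄ at *
  generalize (∑ r ∈ range (R + 1), ∑ k ∈ range p, blockGain m s r k (b r k)) = B₁ at *
  generalize (∑ r ∈ range R, ∑ k ∈ range (u + 1), blockGain m s r (p + k) (b r (p + k))) = B₂ at *
  -- The total number of elements is `-(E₁ + E₂)`; this square handles the term `-|S|²`.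
  have sq := sq_nonneg (2 * (E₁ + E₂) + (R * m + p) * s - R : ℤ)
  have hc : (0 : ℤ) ≤ m * s + 1 := by positivity
  have c1 := mul_nonneg hc a1
  have c2 := mul_nonneg (by positivity : (0 : ℤ) ≤ s) a2
  have c3 := mul_nonneg hc a3
  have c4 := mul_nonneg (by positivity : (0 : ℤ) ≤ s) a4
  rw [hmZ] at *
  push_cast at *
  linarith

end GenBeta

/-! ### The extreme values, and the shapes excluded by the relaxed bound -/

namespace GenBeta

open Finset

/-- Six times the maximal size for `s = 2T`. -/
def evenMax (m T : ℕ) : ℤ := m * T ^ 2 * (m * T ^ 2 + 2 * m - 3)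

/-- Six times the maximal size for `s = 2T + 1`. -/
def oddMax (m T : ℕ) : ℤ := m ^ 2 * T * (T + 1) * (T ^ 2 + T + 1)

variable {m T R p : ℕ} {b : ℕ → ℕ → ℤ}

theorem Shape.lt_evenMax_of_add_two_le (h : Shape m (2 * T) T R p b) (hm : 2 ≤ m)
    (hR : R + 2 ≤ T) : 3 * arrayGain m (2 * T) T b < evenMax m T := by
  suffices 0 < 4 * evenMax m T - 12 * arrayGain m (2 * T) T b by linarith
  refine lt_of_lt_of_le ?_ (sub_le_sub_left h.arrayGain_le _)
  -- Slack variables for all the inequalities turn the distance to the relaxed bound into a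
  -- polynomial without negative coefficients; the sibling lemmas below work the same way.
  obtain ⟨x, rfl⟩ := Nat.exists_eq_add_of_le hR
  have hp := h.p_lt
  rcases Nat.eq_zero_or_pos p with rfl | hp0
  · obtain ⟨v, rfl⟩ := Nat.exists_eq_add_of_le hm
    rw [evenMax]; push_cast; ring_nf; positivity
  · obtain ⟨q, rfl⟩ := Nat.exists_eq_add_of_le (Nat.succ_le_of_lt hp0)
    obtain ⟨v, rfl⟩ := Nat.exists_eq_add_of_le (Nat.succ_le_of_lt hp)
    rw [evenMax]; push_cast; ring_nf; positivity

theorem Shape.lt_evenMax_of_last_row (h : Shape m (2 * T) T R p b)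
    (hR : R + 1 = T) (hp : 0 < p) (hpm : p + 2 ≤ m) :
    3 * arrayGain m (2 * T) T b < evenMax m T := by
  suffices 0 < 4 * evenMax m T - 12 * arrayGain m (2 * T) T b by linarith
  refine lt_of_lt_of_le ?_ (sub_le_sub_left h.arrayGain_le _)
  subst hR
  obtain ⟨q, rfl⟩ := Nat.exists_eq_add_of_le (Nat.succ_le_of_lt hp)
  obtain ⟨v, rfl⟩ := Nat.exists_eq_add_of_le hpm
  rw [evenMax]; push_cast; ring_nf; positivity

theorem Shape.lt_oddMax_of_add_two_le (h : Shape m (2 * T + 1) T R p b) (hm : 2 ≤ m)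
    (hR : R + 2 ≤ T) : 3 * arrayGain m (2 * T + 1) T b < oddMax m T := by
  suffices 0 < 4 * oddMax m T - 12 * arrayGain m (2 * T + 1) T b by linarith
  refine lt_of_lt_of_le ?_ (sub_le_sub_left h.arrayGain_le _)
  obtain ⟨x, rfl⟩ := Nat.exists_eq_add_of_le hR
  have hp := h.p_lt
  rcases Nat.eq_zero_or_pos p with rfl | hp0
  · obtain ⟨v, rfl⟩ := Nat.exists_eq_add_of_le hm
    rw [oddMax]; push_cast; ring_nf; positivity
  · obtain ⟨q, rfl⟩ := Nat.exists_eq_add_of_le (Nat.succ_le_of_lt hp0)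
    obtain ⟨v, rfl⟩ := Nat.exists_eq_add_of_le (Nat.succ_le_of_lt hp)
    rw [oddMax]; push_cast; ring_nf; positivity

theorem Shape.lt_oddMax_of_empty_last_row (h : Shape m (2 * T + 1) T R 0 b) (hm : 2 ≤ m)
    (hR : R + 1 = T) : 3 * arrayGain m (2 * T + 1) T b < oddMax m T := by
  suffices 0 < 4 * oddMax m T - 12 * arrayGain m (2 * T + 1) T b by linarith
  refine lt_of_lt_of_le ?_ (sub_le_sub_left h.arrayGain_le _)
  subst hR
  obtain ⟨v, rfl⟩ := Nat.exists_eq_add_of_le hm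
  rw [oddMax]; push_cast; ring_nf; positivity

/-- The size in terms of the deficiencies `e` of the blocks, for even `s`. -/
theorem three_mul_arrayGain_even (w T : ℕ) (e : ℕ → ℕ → ℤ) :
    3 * arrayGain (w + 1) (2 * T) T (fun r k => 2 * T - 1 - 2 * r - e r k) = evenMax (w + 1) T +
      3 * (2 * w * T ^ 2 + (T - 1) * ∑ r ∈ range T, ∑ k ∈ range (w + 1), e r k
        - (∑ r ∈ range T, ∑ k ∈ range (w + 1), e r k) ^ 2
        - ∑ r ∈ range T, ∑ k ∈ range (w + 1), e r k ^ 2 + 2 * ∑ r ∈ range T, e r w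
        - (2 * (w + 1) * T + 1) *
          ∑ r ∈ range T, ∑ k ∈ range (w + 1), (2 * (r : ℤ) - (T - 1)) * e r k
        - 2 * T * ∑ r ∈ range T, ∑ k ∈ range (w + 1), (2 * (k : ℤ) - w) * e r k) := by
  have g := three_mul_sum_blockGain (w + 1) (2 * T) T (w + 1) 0 T e
  have hb : ∀ r k, (T : ℤ) - e r k - (2 * (r : ℤ) - (T - 1)) = 2 * T - 1 - 2 * r - e r k :=
    fun r k => by ring
  have hc := sum_centered T
  have h1 : ∀ r k, 2 * (T : ℤ) - 1 - 2 * r - e r k = T - (2 * (r : ℤ) - (T - 1)) - e r k :=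
    fun r k => by ring
  have h2 : ∑ r ∈ range T, (2 * (T : ℤ) - 1 - 2 * r - e r w) =
      T * T - ∑ r ∈ range T, e r w := by
    rw [sum_congr rfl fun r _ => h1 r w, sum_sub_distrib, sum_sub_distrib, hc]
    simp
  have h3 : ∑ r ∈ range T, ∑ k ∈ range (w + 1), (2 * (T : ℤ) - 1 - 2 * r - e r k) =
      (w + 1) * (T * T) - ∑ r ∈ range T, ∑ k ∈ range (w + 1), e r k := by
    have : ∀ r, ∑ k ∈ range (w + 1), (2 * (T : ℤ) - 1 - 2 * r - e r k) =
        (w + 1) * (T - (2 * (r : ℤ) - (T - 1))) - ∑ k ∈ range (w + 1), e r k := fun r => by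
      rw [sum_sub_distrib, sum_const, card_range, nsmul_eq_mul]
      push_cast; ring
    simp only [this, sum_sub_distrib (f := fun r => (_ : ℤ) * _), ← mul_sum]
    rw [sum_sub_distrib, hc]
    simp
  simp only [hb, zero_add] at g
  rw [arrayGain, Nat.add_sub_cancel]
  simp only [h2, h3]
  have hw : ∀ k : ℕ, (2 * (k : ℤ) - ((w + 1 : ℕ) - 1)) = 2 * k - w := fun k => by push_cast; ring
  simp only [hw] at g
  rw [evenMax]
  push_cast at *
  linear_combination g

/-- The size in terms of the deficiencies `e` of the blocks, for odd `s`. -/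
theorem three_mul_arrayGain_odd (w T : ℕ) (e : ℕ → ℕ → ℤ) :
    3 * arrayGain (w + 1) (2 * T + 1) T (fun r k => 2 * T - 2 * r - e r k) = oddMax (w + 1) T +
      3 * ((w - 1) * T * (T + 1) + (w + 2) * T * ∑ r ∈ range T, ∑ k ∈ range (w + 1), e r k
        - (∑ r ∈ range T, ∑ k ∈ range (w + 1), e r k) ^ 2
        - ∑ r ∈ range T, ∑ k ∈ range (w + 1), e r k ^ 2 + 2 * ∑ r ∈ range T, e r w
        - ((w + 1) * (2 * T + 1) + 1) *
          ∑ r ∈ range T, ∑ k ∈ range (w + 1), (2 * (r : ℤ) - (T - 1)) * e r k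
        - (2 * T + 1) * ∑ r ∈ range T, ∑ k ∈ range (w + 1), (2 * (k : ℤ) - w) * e r k) := by
  have g := three_mul_sum_blockGain (w + 1) (2 * T + 1) T (w + 1) 0 (T + 1) e
  have hb : ∀ r k, (T + 1 : ℤ) - e r k - (2 * (r : ℤ) - (T - 1)) = 2 * T - 2 * r - e r k :=
    fun r k => by ring
  have hc := sum_centered T
  have h1 : ∀ r k, 2 * (T : ℤ) - 2 * r - e r k = (T + 1) - (2 * (r : ℤ) - (T - 1)) - e r k :=
    fun r k => by ring
  have h2 : ∑ r ∈ range T, (2 * (T : ℤ) - 2 * r - e r w) =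
      T * (T + 1) - ∑ r ∈ range T, e r w := by
    rw [sum_congr rfl fun r _ => h1 r w, sum_sub_distrib, sum_sub_distrib, hc]
    simp
  have h3 : ∑ r ∈ range T, ∑ k ∈ range (w + 1), (2 * (T : ℤ) - 2 * r - e r k) =
      (w + 1) * (T * (T + 1)) - ∑ r ∈ range T, ∑ k ∈ range (w + 1), e r k := by
    have : ∀ r, ∑ k ∈ range (w + 1), (2 * (T : ℤ) - 2 * r - e r k) =
        (w + 1) * ((T + 1) - (2 * (r : ℤ) - (T - 1))) - ∑ k ∈ range (w + 1), e r k := fun r => by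
      rw [sum_sub_distrib, sum_const, card_range, nsmul_eq_mul]
      push_cast; ring
    simp only [this, sum_sub_distrib (f := fun r => (_ : ℤ) * _), ← mul_sum]
    rw [sum_sub_distrib, hc]
    simp
  simp only [hb, zero_add] at g
  rw [arrayGain, Nat.add_sub_cancel]
  simp only [h2, h3]
  have hw : ∀ k : ℕ, (2 * (k : ℤ) - ((w + 1 : ℕ) - 1)) = 2 * k - w := fun k => by push_cast; ring
  simp only [hw] at g
  rw [oddMax]
  push_cast at *
  linear_combination g

end GenBeta

/-! ### Even `s` with an empty last row -/

namespace GenBeta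

open Finset

variable {m s T R p : ℕ} {b : ℕ → ℕ → ℤ}

theorem arrayGain_congr (hm : 0 < m) {b' : ℕ → ℕ → ℤ}
    (h : ∀ r < T, ∀ k < m, b r k = b' r k) : arrayGain m s T b = arrayGain m s T b' := by
  have h1 : ∑ r ∈ range T, ∑ k ∈ range m, b r k = ∑ r ∈ range T, ∑ k ∈ range m, b' r k :=
    sum_congr rfl fun r hr => sum_congr rfl fun k hk => h r (mem_range.1 hr) k (mem_range.1 hk)
  have h2 : ∑ r ∈ range T, ∑ k ∈ range m, blockGain m s r k (b r k) =
      ∑ r ∈ range T, ∑ k ∈ range m, blockGain m s r k (b' r k) :=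
    sum_congr rfl fun r hr => sum_congr rfl fun k hk => by
      rw [h r (mem_range.1 hr) k (mem_range.1 hk)]
  have h3 : ∑ r ∈ range T, b r (m - 1) = ∑ r ∈ range T, b' r (m - 1) :=
    sum_congr rfl fun r hr => h r (mem_range.1 hr) _ (by omega)
  rw [arrayGain, arrayGain, h1, h2, h3]

/-- Column `k` grows by at least two per row when going down from row `l`. -/
theorem Shape.le_of_column (h : Shape m s T R p b) {k l : ℕ} (hk : k < m)
    (hpos : ∀ r ≤ l, 0 < b r k) {r : ℕ} (hr : r ≤ l) : 1 + 2 * ((l : ℤ) - r) ≤ b r k := by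
  obtain ⟨j, rfl⟩ := Nat.exists_eq_add_of_le hr
  clear hr
  induction j generalizing r with
  | zero => have := hpos r le_rfl; push_cast; linarith
  | succ j ih =>
    have h1 := ih (r := r + 1) (by rwa [show r + 1 + j = r + (j + 1) by ring])
    have h2 := h.col r k hk (hpos (r + 1) (by omega))
    push_cast at *
    linarith

/-- Here the reference staircase is `2R - 2r`, and integrality replaces completing the square: `x² +
x ≥ 0` and `x(x-1) ≥ 0` for integers `x`. -/
theorem Shape.lt_evenMax_of_empty_last_row (h : Shape m (2 * T) T R 0 b) (hm : 2 ≤ m)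
    (hR : R + 1 = T) : 3 * arrayGain m (2 * T) T b < evenMax m T := by
  obtain ⟨w, rfl⟩ : ∃ w, m = w + 1 := ⟨m - 1, by omega⟩
  have hR0 : 0 < R := by
    have := h.size_pos
    by_contra hc
    simp [show R = 0 by omega] at this
  set e : ℕ → ℕ → ℤ := fun r k => T - b r k - (2 * (r : ℤ) - (R - 1)) with he
  have g := three_mul_sum_blockGain (w + 1) (2 * T) R (w + 1) 0 T e
  have hb : ∀ r k, (T : ℤ) - e r k - (2 * (r : ℤ) - (R - 1)) = b r k := fun r k => by
    simp only [he]; ring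
  have hs := h.sum_eq (f := fun r k => blockGain (w + 1) (2 * T) r k (b r k)) fun r k _ hb => by
    simp [blockGain, hb]
  have hn := h.sum_eq (f := b) fun r k _ hb => hb
  simp only [range_zero, sum_empty, sum_const_zero, zero_add, Nat.sub_zero] at hs hn
  have hmono : ∀ r, r + 1 < R → ∀ k < w + 1, e r k ≤ e (r + 1) k := fun r hr k hk => by
    have := h.col_of_pos (r := r) (k := k) (by omega) hk (by omega)
    simp only [he]; push_cast; linarith
  have a2 : 0 ≤ ∑ r ∈ range R, ∑ k ∈ range (w + 1),
      (2 * (k : ℤ) - ((w + 1 : ℕ) - 1)) * e r k :=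
    sum_centered_cols_nonneg fun r _ k hk => by
      have := h.row r k hk
      simp only [he]; linarith
  set X : ℕ → ℤ := fun r => ∑ k ∈ range (w + 1), e r k with hX
  have hXm : ∀ r, r + 1 < R → X r ≤ X (r + 1) := fun r hr =>
    sum_le_sum fun k hk => hmono r hr k (mem_range.1 hk)
  have a1 : ∑ r ∈ range R, ∑ k ∈ range (w + 1), (2 * (r : ℤ) - (R - 1)) * e r k =
      ∑ r ∈ range R, (2 * (r : ℤ) - (R - 1)) * X r :=
    sum_congr rfl fun r _ => by rw [hX, mul_sum]
  have a3 : 0 ≤ ∑ r ∈ range R, (2 * (r : ℤ) - (R - 1)) * X r := sum_centered_nonneg hXm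
  -- If the row sums are not constant, their moment is at least `R - 1`, which outweighs the left
  -- side, at most `R²/4`. If they all equal `x`, the left side is `-R² x(x-1) ≤ 0`.
  have key : R * ∑ r ∈ range R, X r - (∑ r ∈ range R, X r) ^ 2 ≤
      ((w + 1) * (2 * T) + 1) * ∑ r ∈ range R, (2 * (r : ℤ) - (R - 1)) * X r := by
    by_cases hc : ∃ j, j + 1 < R ∧ X j < X (j + 1)
    · obtain ⟨j, hj, hlt⟩ := hc
      have h1 := le_sum_centered_of_lt hXm hj hlt
      have h2 : (R : ℤ) + 1 = T := by exact_mod_cast hR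
      have h3 : (2 : ℤ) ≤ R := by exact_mod_cast (by omega : 2 ≤ R)
      have h4 : (0 : ℤ) ≤ w := by positivity
      rw [← h2]
      nlinarith [sq_nonneg (2 * ∑ r ∈ range R, X r - R : ℤ),
        mul_le_mul_of_nonneg_left h1 (by positivity : (0 : ℤ) ≤ (w + 1) * (2 * (R + 1)) + 1),
        mul_nonneg h4 (by positivity : (0 : ℤ) ≤ R)]
    · push Not at hc
      have h1 : ∀ r < R, X r = X 0 := fun r hr =>
        le_antisymm (le_of_antitone_range hc (Nat.zero_le r) hr)
          (neg_le_neg_iff.1 (le_of_antitone_range (z := fun i => -X i)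
            (fun i hi => neg_le_neg (hXm i hi)) (Nat.zero_le r) hr))
      have h2 : ∑ r ∈ range R, X r = R * X 0 := by
        rw [sum_congr rfl fun r hr => h1 r (mem_range.1 hr)]; simp
      have h3 : 0 ≤ X 0 * (X 0 - 1) := by
        rcases le_or_gt (X 0) 0 with h | h
        · exact mul_nonneg_of_nonpos_of_nonpos h (by linarith)
        · exact mul_nonneg h.le (by linarith)
      rw [h2]
      have h4 := mul_nonneg (sq_nonneg (R : ℤ)) h3
      have h5 := mul_nonneg (by positivity : (0 : ℤ) ≤ (w + 1) * (2 * T) + 1) a3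
      linarith
  have hint : ∀ x : ℤ, 0 ≤ x ^ 2 + x := fun x => by
    rcases le_or_gt 0 x with h | h
    · positivity
    · nlinarith
  have q : 0 ≤ ∑ r ∈ range R, (∑ k ∈ range (w + 1), (e r k ^ 2 + e r k) - 2 * e r w) :=
    sum_nonneg fun r _ => by
      rw [sum_range_succ]
      have h1 : 0 ≤ ∑ k ∈ range w, (e r k ^ 2 + e r k) := sum_nonneg fun k _ => hint _
      have h2 := hint (-e r w)
      linarith
  simp only [sum_sub_distrib, sum_add_distrib, ← mul_sum] at q
  replace q : 0 ≤ ∑ r ∈ range R, ∑ k ∈ range (w + 1), e r k ^ 2 + ∑ r ∈ range R, X r -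
    2 * ∑ r ∈ range R, e r w := q
  have hc := sum_centered R
  have h1 : ∀ r k, b r k = T - (2 * (r : ℤ) - (R - 1)) - e r k := fun r k => by
    simp only [he]; ring
  have hl : ∑ r ∈ range T, b r (w + 1 - 1) = R * T - ∑ r ∈ range R, e r w := by
    rw [h.sum_last_eq, Nat.add_sub_cancel, sum_congr rfl fun r _ => h1 r w, sum_sub_distrib,
      sum_sub_distrib, hc]
    simp
  have hn' : ∑ r ∈ range R, ∑ k ∈ range (w + 1), b r k =
      (w + 1) * (R * T) - ∑ r ∈ range R, X r := by
    have : ∀ r, ∑ k ∈ range (w + 1), b r k =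
        (w + 1) * (T - (2 * (r : ℤ) - (R - 1))) - X r := fun r => by
      rw [sum_congr rfl fun k _ => h1 r k, sum_sub_distrib, sum_const, card_range, nsmul_eq_mul]
      push_cast; ring
    rw [sum_congr rfl fun r _ => this r, sum_sub_distrib, ← mul_sum, sum_sub_distrib, hc]
    simp
  simp only [hb, zero_add, a1] at g
  rw [arrayGain, hs, hn, hn', hl, evenMax]
  have c2 := mul_nonneg (by positivity : (0 : ℤ) ≤ 2 * T) a2
  have hTR : (T : ℤ) = R + 1 := by exact_mod_cast hR.symm
  have hRp : (0 : ℤ) < R := by exact_mod_cast hR0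
  have hwp : (1 : ℤ) ≤ w := by exact_mod_cast (by omega : 1 ≤ w)
  -- One third of the distance from `evenMax` to three times the gain at `e = 0`.
  have fin : (0 : ℤ) < (w - 1) * (w * T ^ 2 + T) + (w + 1) * T := by
    have : (0 : ℤ) < T := by linarith
    have : (0 : ℤ) ≤ w - 1 := by linarith
    positivity
  rw [hTR] at key c2 fin hn' hl g ⊢
  push_cast at *
  rw [hTR] at *
  linarith

end GenBeta

/-! ### The extremal shapes and their equality cases -/

namespace GenBeta

open Finset

variable {m s T R p : ℕ} {b : ℕ → ℕ → ℤ}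

/-- The size when all columns but the last are full, for even `s`. -/
theorem three_mul_arrayGain_of_last_column (w R : ℕ) (d : ℕ → ℤ)
    (hb : ∀ r < R + 1, ∀ k < w, b r k = 2 * R + 1 - 2 * r)
    (hlast : ∀ r < R, b r w = 2 * R - 2 * r - d r) (hzero : b R w = 0) :
    3 * arrayGain (w + 1) (2 * (R + 1)) (R + 1) b = evenMax (w + 1) (R + 1) +
      3 * ((∑ r ∈ range R, d r) * (R - ∑ r ∈ range R, d r) - ∑ r ∈ range R, (d r ^ 2 - d r)
        - (2 * (w + 1) * (R + 1) + 1) * ∑ r ∈ range R, (2 * (r : ℤ) - (R - 1)) * d r) := by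
  -- Deficiency from `2T - 1 - 2r`, the window size of the other columns; the last column has one
  -- place less, hence `1 + d`, and its empty last block has deficiency `1`.
  set e : ℕ → ℕ → ℤ := fun r k => if k < w then 0 else if r < R then 1 + d r else 1 with he
  have h1 : arrayGain (w + 1) (2 * (R + 1)) (R + 1) b =
      arrayGain (w + 1) (2 * (R + 1)) (R + 1)
        (fun r k => 2 * ((R + 1 : ℕ) : ℤ) - 1 - 2 * r - e r k) := by
    refine arrayGain_congr (Nat.succ_pos w) fun r hr k hk => ?_
    simp only [he]
    split_ifs with h h'
    · rw [hb r hr k h]; push_cast; ring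
    · rw [show k = w by omega, hlast r h']; push_cast; ring
    · rw [show k = w by omega, show r = R by omega, hzero]; push_cast; ring
  rw [h1, three_mul_arrayGain_even]
  have row : ∀ (c : ℕ → ℤ) (g : ℤ → ℤ) (r : ℕ), g 0 = 0 →
      ∑ k ∈ range (w + 1), c k * g (e r k) = c w * g (e r w) := fun c g r hg => by
    rw [sum_range_succ, sum_eq_zero, zero_add]
    intro k hk
    simp [he, mem_range.1 hk, hg]
  have E1 := fun r => row (fun _ => 1) id r rfl
  have E2 := fun r => row (fun _ => 1) (fun x => x ^ 2) r (by simp)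
  have E3 := fun r : ℕ => row (fun _ => 2 * (r : ℤ) - ((R + 1 : ℕ) - 1)) id r rfl
  have E4 := fun r => row (fun k => 2 * (k : ℤ) - w) id r rfl
  simp only [one_mul, id] at E1 E2 E3 E4
  simp only [E1, E2, E3, E4]
  have hw : ∀ r, r < R → e r w = 1 + d r := fun r hr => by simp [he, hr]
  have hR : e R w = 1 := by simp [he]
  have S1 : ∑ r ∈ range (R + 1), e r w = R + ∑ r ∈ range R, d r + 1 := by
    rw [sum_range_succ, hR, sum_congr rfl fun r hr => hw r (mem_range.1 hr), sum_add_distrib]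
    simp
  have S2 : ∑ r ∈ range (R + 1), e r w ^ 2 =
      R + 3 * ∑ r ∈ range R, d r + ∑ r ∈ range R, (d r ^ 2 - d r) + 1 := by
    have : ∀ r ∈ range R, e r w ^ 2 = 1 + 3 * d r + (d r ^ 2 - d r) := fun r hr => by
      rw [hw r (mem_range.1 hr)]; ring
    rw [sum_range_succ, hR, sum_congr rfl this, sum_add_distrib, sum_add_distrib, ← mul_sum]
    simp
  have S3 : ∑ r ∈ range (R + 1), (2 * (r : ℤ) - ((R + 1 : ℕ) - 1)) * e r w =
      ∑ r ∈ range R, (2 * (r : ℤ) - (R - 1)) * d r - ∑ r ∈ range R, d r := by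
    have : ∀ r ∈ range R, (2 * (r : ℤ) - ((R + 1 : ℕ) - 1)) * e r w =
        (2 * (r : ℤ) - (R - 1)) * d r - d r + ((2 * (r : ℤ) - (R - 1)) - 1) := fun r hr => by
      rw [hw r (mem_range.1 hr)]; push_cast; ring
    rw [sum_range_succ, hR, sum_congr rfl this, sum_add_distrib, sum_sub_distrib, sum_sub_distrib,
      sum_centered]
    simp
    ring
  have S4 : ∑ r ∈ range (R + 1), (2 * (w : ℤ) - w) * e r w =
      w * (R + ∑ r ∈ range R, d r + 1) := by
    rw [← mul_sum, S1]; ring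
  rw [S1, S2, S3, S4]
  push_cast
  ring

theorem sum_eq_zero_or_one {ι : Type*} {A : Finset ι} {d : ι → ℤ} (h0 : ∀ i ∈ A, 0 ≤ d i)
    (h1 : ∀ i ∈ A, d i ≤ 1) (h : (∑ i ∈ A, d i) * (A.card - ∑ i ∈ A, d i) = 0) :
    (∀ i ∈ A, d i = 0) ∨ (∀ i ∈ A, d i = 1) := by
  rcases mul_eq_zero.1 h with h | h
  · exact Or.inl ((sum_eq_zero_iff_of_nonneg h0).1 h)
  · right
    have : ∑ i ∈ A, (1 - d i) = 0 := by rw [sum_sub_distrib]; simpa using h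
    intro i hi
    have := (sum_eq_zero_iff_of_nonneg (fun i hi => by linarith [h1 i hi])).1 this i hi
    linarith

/-- A column nonempty down to row `R` and growing by two per row upwards is at least as large as its
window, so it fills it. -/
theorem Shape.eq_of_full_column (h : Shape m (2 * (R + 1)) (R + 1) R p b) {r k : ℕ}
    (hr : r < R + 1) (hk : k < p) : b r k = 2 * R + 1 - 2 * r := by
  have hp := h.p_lt
  have h1 := h.le_of_column (l := R) (hk.trans hp) (fun i hi => by
    rcases hi.eq_or_lt with rfl | hi
    · exact h.pos_last k hk
    · exact h.pos i k hi (hk.trans hp)) (Nat.lt_succ_iff.1 hr)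
  have h2 := h.cap r k hr (by omega)
  push_cast at *
  linarith

/-- The bound for even `s` when the array has the maximal number of nonempty blocks. -/
theorem Shape.le_evenMax (h : Shape m (2 * (R + 1)) (R + 1) R p b) (hp : p + 1 = m) :
    3 * arrayGain m (2 * (R + 1)) (R + 1) b ≤ evenMax m (R + 1) ∧
      (3 * arrayGain m (2 * (R + 1)) (R + 1) b = evenMax m (R + 1) →
        (∀ r < R, b r p = 2 * R - 2 * r) ∨ ∀ r < R, b r p = 2 * R - 2 * r - 1) := by
  subst hp
  set d : ℕ → ℤ := fun r => 2 * R - 2 * r - b r p with hd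
  have key := three_mul_arrayGain_of_last_column p R d
    (fun r hr k hk => h.eq_of_full_column hr hk) (fun r _ => by simp only [hd]; ring)
    (h.zero_last p le_rfl (Nat.lt_succ_self p))
  have d0 : ∀ r < R, 0 ≤ d r := fun r hr => by
    have := h.cap_last r (by omega)
    rw [Nat.add_sub_cancel] at this
    simp only [hd]
    push_cast at this
    linarith
  have dm : ∀ r, r + 1 < R → d r ≤ d (r + 1) := fun r hr => by
    have := h.col_of_pos (r := r) (k := p) (by omega) (by omega) (by omega)
    simp only [hd]; push_cast; linarith
  have c1 := sum_centered_nonneg dm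
  have c2 := mul_le_sum_centered d0 dm
  have dint : ∀ r ∈ range R, 0 ≤ d r ^ 2 - d r := fun r hr => by
    have := d0 r (mem_range.1 hr)
    rcases this.eq_or_lt with h | h
    · simp [← h]
    · nlinarith
  have c3 := sum_nonneg dint
  -- One copy of the moment pays for `D(R - D)`; this is the rest of its coefficient. Since it is
  -- positive, equality forces the moment to vanish.
  have c4 : 0 ≤ (2 * (p + 1) * (R + 1) : ℤ) * ∑ r ∈ range R, (2 * (r : ℤ) - (R - 1)) * d r :=
    mul_nonneg (by positivity) c1
  refine ⟨by linarith, fun heq => ?_⟩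
  have c5 : (2 * (p + 1) * (R + 1) : ℤ) * ∑ r ∈ range R, (2 * (r : ℤ) - (R - 1)) * d r = 0 := by
    linarith
  have c6 : ∑ r ∈ range R, (2 * (r : ℤ) - (R - 1)) * d r = 0 :=
    (mul_eq_zero.1 c5).resolve_left (by positivity)
  have c7 : ∑ r ∈ range R, (d r ^ 2 - d r) = 0 := by linarith
  have c8 : (∑ r ∈ range R, d r) * (R - ∑ r ∈ range R, d r) = 0 := by linarith
  have d1 : ∀ r ∈ range R, d r ≤ 1 := fun r hr => by
    have h1 := (sum_eq_zero_iff_of_nonneg dint).1 c7 r hr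
    have h2 := d0 r (mem_range.1 hr)
    nlinarith
  rcases sum_eq_zero_or_one (fun r hr => d0 r (mem_range.1 hr)) d1 (by simpa using c8) with h | h
  · exact Or.inl fun r hr => by
      have := h r (mem_range.2 hr)
      simp only [hd] at this; linarith
  · exact Or.inr fun r hr => by
      have := h r (mem_range.2 hr)
      simp only [hd] at this; linarith

/-- The size for odd `s` when all blocks are nonempty; `τ` records the blocks that are one short
of being full, and these lose their largest admissible element. -/
theorem three_mul_arrayGain_of_full (w T : ℕ) (τ : ℕ → ℕ → ℤ)
    (hτ : ∀ r < T, ∀ k < w, τ r k ^ 2 = τ r k)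
    (hb : ∀ r < T, ∀ k < w, b r k = 2 * T - 2 * r - τ r k)
    (hlast : ∀ r < T, b r w = 2 * T - 2 * r - 1) :
    3 * (arrayGain (w + 1) (2 * T + 1) T b -
        2 * ∑ r ∈ range T, ∑ k ∈ range w, τ r k * b r k) = oddMax (w + 1) T +
      3 * ((∑ r ∈ range T, ∑ k ∈ range w, τ r k) *
          (T * w - ∑ r ∈ range T, ∑ k ∈ range w, τ r k)
        - ((w + 1) * (2 * T + 1) - 1) *
          ∑ r ∈ range T, ∑ k ∈ range w, (2 * (r : ℤ) - (T - 1)) * τ r k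
        - (2 * T + 1) * ∑ r ∈ range T, ∑ k ∈ range w, (2 * (k : ℤ) - (w - 1)) * τ r k) := by
  set e : ℕ → ℕ → ℤ := fun r k => if k < w then τ r k else 1 with he
  have h1 : arrayGain (w + 1) (2 * T + 1) T b =
      arrayGain (w + 1) (2 * T + 1) T (fun r k => 2 * (T : ℤ) - 2 * r - e r k) := by
    refine arrayGain_congr (Nat.succ_pos w) fun r hr k hk => ?_
    simp only [he]
    split_ifs with h
    · exact hb r hr k h
    · rw [show k = w by omega, hlast r hr]
  have hew : ∀ r, e r w = 1 := fun r => by simp [he]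
  have hek : ∀ r, ∀ k ∈ range w, e r k = τ r k := fun r k hk => by simp [he, mem_range.1 hk]
  have S0 : ∑ r ∈ range T, ∑ k ∈ range w, τ r k * b r k =
      T * ∑ r ∈ range T, ∑ k ∈ range w, τ r k -
        ∑ r ∈ range T, ∑ k ∈ range w, (2 * (r : ℤ) - (T - 1)) * τ r k := by
    simp only [mul_sum, ← sum_sub_distrib]
    refine sum_congr rfl fun r hr => sum_congr rfl fun k hk => ?_
    rw [hb r (mem_range.1 hr) k (mem_range.1 hk)]
    linear_combination -(hτ r (mem_range.1 hr) k (mem_range.1 hk))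
  have S1 : ∑ r ∈ range T, ∑ k ∈ range (w + 1), e r k =
      ∑ r ∈ range T, ∑ k ∈ range w, τ r k + T := by
    simp only [sum_range_succ, hew, sum_congr rfl (hek _), sum_add_distrib]
    simp
  have S2 : ∑ r ∈ range T, ∑ k ∈ range (w + 1), e r k ^ 2 =
      ∑ r ∈ range T, ∑ k ∈ range w, τ r k + T := by
    rw [← S1]
    refine sum_congr rfl fun r hr => sum_congr rfl fun k hk => ?_
    simp only [he]
    split_ifs with h
    · exact hτ r (mem_range.1 hr) k h
    · norm_num
  have S3 : ∑ r ∈ range T, ∑ k ∈ range (w + 1), (2 * (r : ℤ) - (T - 1)) * e r k =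
      ∑ r ∈ range T, ∑ k ∈ range w, (2 * (r : ℤ) - (T - 1)) * τ r k := by
    simp only [← mul_sum, sum_range_succ, hew, sum_congr rfl (hek _), mul_add, mul_one,
      sum_add_distrib]
    rw [sum_centered, add_zero]
  have S4 : ∑ r ∈ range T, ∑ k ∈ range (w + 1), (2 * (k : ℤ) - w) * e r k =
      ∑ r ∈ range T, ∑ k ∈ range w, (2 * (k : ℤ) - (w - 1)) * τ r k -
        ∑ r ∈ range T, ∑ k ∈ range w, τ r k + T * w := by
    have : ∀ r, ∑ k ∈ range (w + 1), (2 * (k : ℤ) - w) * e r k =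
        ∑ k ∈ range w, (2 * (k : ℤ) - (w - 1)) * τ r k - ∑ k ∈ range w, τ r k + w := fun r => by
      rw [sum_range_succ, hew, ← sum_sub_distrib]
      congr 1
      · refine sum_congr rfl fun k hk => ?_
        rw [hek r k hk]; ring
      · ring
    simp only [this, sum_add_distrib, sum_sub_distrib]
    simp
  have S5 : ∑ r ∈ range T, e r w = T := by simp [hew]
  have key := three_mul_arrayGain_odd w T e
  rw [mul_sub, h1, key, S0, S1, S2, S3, S4, S5]
  ring

/-- Together with the caps this leaves sizes `2T - 2r` or `2T - 2r - 1`, and only the latter in the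
last column. -/
theorem Shape.odd_bounds (h : Shape m (2 * T + 1) T T 0 b) {r k : ℕ} (hr : r < T) (hk : k < m) :
    2 * T - 2 * r - 1 ≤ b r k := by
  obtain ⟨l, rfl⟩ : ∃ l, T = l + 1 := ⟨T - 1, by omega⟩
  have := h.le_of_column (l := l) hk (fun i hi => h.pos i k (by omega) hk) (r := r) (by omega)
  push_cast
  linarith

/-- The bound for odd `s` when all blocks are nonempty. -/
theorem Shape.le_oddMax {w : ℕ} (h : Shape (w + 1) (2 * T + 1) T T 0 b) (hw : 1 ≤ w) :
    3 * (arrayGain (w + 1) (2 * T + 1) T b -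
        2 * ∑ r ∈ range T, ∑ k ∈ range w, (2 * T - 2 * r - b r k) * b r k) ≤ oddMax (w + 1) T ∧
      (3 * (arrayGain (w + 1) (2 * T + 1) T b -
        2 * ∑ r ∈ range T, ∑ k ∈ range w, (2 * T - 2 * r - b r k) * b r k) = oddMax (w + 1) T →
        (∀ r < T, ∀ k < w, b r k = 2 * T - 2 * r) ∨
          ∀ r < T, ∀ k < w, b r k = 2 * T - 2 * r - 1) := by
  have hlast : ∀ r < T, b r w = 2 * T - 2 * r - 1 := fun r hr => by
    have h1 := h.odd_bounds hr (Nat.lt_succ_self w)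
    have h2 := h.cap_last r hr
    rw [Nat.add_sub_cancel] at h2
    push_cast at h2
    linarith
  set τ : ℕ → ℕ → ℤ := fun r k => 2 * T - 2 * r - b r k with hτ
  have t0 : ∀ r < T, ∀ k < w, 0 ≤ τ r k := fun r hr k hk => by
    have := h.cap r k hr (by omega)
    simp only [hτ]; push_cast at this; linarith
  have t1 : ∀ r < T, ∀ k < w, τ r k ≤ 1 := fun r hr k hk => by
    have := h.odd_bounds hr (hk.trans (Nat.lt_succ_self w))
    simp only [hτ]; linarith
  have tr : ∀ r, r + 1 < T → ∀ k < w, τ r k ≤ τ (r + 1) k := fun r hr k hk => by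
    have := h.col_of_pos (r := r) (k := k) (by omega) (by omega) (by omega)
    simp only [hτ]; push_cast; linarith
  have tk : ∀ r < T, ∀ k, k + 1 < w → τ r k ≤ τ r (k + 1) := fun r hr k hk => by
    have := h.row r k (by omega)
    simp only [hτ]; linarith
  have key := three_mul_arrayGain_of_full w T τ (fun r hr k hk => by
      have h0 := t0 r hr k hk
      have h1 := t1 r hr k hk
      rcases h0.eq_or_lt with h0 | h0
      · simp [← h0]
      · rw [show τ r k = 1 by linarith]; norm_num)
    (fun r _ k _ => by simp only [hτ]; ring) hlast
  have c1 := sum_centered_rows_nonneg tr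
  have c2 := sum_centered_cols_nonneg tk
  have c3 := mul_le_sum_centered_grid t0 t1 tr tk
  set A := ∑ r ∈ range T, ∑ k ∈ range w, (2 * (r : ℤ) - (T - 1)) * τ r k
  set B := ∑ r ∈ range T, ∑ k ∈ range w, (2 * (k : ℤ) - (w - 1)) * τ r k
  -- The grid inequality uses up `w` copies of `A` and `T` copies of `B`; these are the remaining
  -- coefficients.
  have c4 : 0 ≤ (2 * T * (w + 1) : ℤ) * A := mul_nonneg (by positivity) c1
  have c5 : 0 ≤ (T + 1 : ℤ) * B := mul_nonneg (by positivity) c2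
  refine ⟨by linarith, fun heq => ?_⟩
  rcases Nat.eq_zero_or_pos T with rfl | hT
  · exact Or.inl fun r hr => absurd hr (Nat.not_lt_zero r)
  have c6 : (2 * T * (w + 1) : ℤ) * A = 0 := by linarith
  have c7 : (T + 1 : ℤ) * B = 0 := by linarith
  have c8 : A = 0 := (mul_eq_zero.1 c6).resolve_left (by positivity)
  have c9 : B = 0 := (mul_eq_zero.1 c7).resolve_left (by positivity)
  have c10 : (∑ r ∈ range T, ∑ k ∈ range w, τ r k) *
      (T * w - ∑ r ∈ range T, ∑ k ∈ range w, τ r k) = 0 := by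
    rw [c8, c9] at key
    linarith
  have c11 := sum_eq_zero_or_one (A := range T ×ˢ range w) (d := fun x => τ x.1 x.2)
    (fun x hx => by
      rw [mem_product, mem_range, mem_range] at hx
      exact t0 _ hx.1 _ hx.2)
    (fun x hx => by
      rw [mem_product, mem_range, mem_range] at hx
      exact t1 _ hx.1 _ hx.2)
    (by rw [sum_product]; simpa using c10)
  refine c11.imp (fun h r hr k hk => ?_) (fun h r hr k hk => ?_) <;>
  · have := h (r, k) (by rw [mem_product, mem_range, mem_range]; exact ⟨hr, hk⟩)
    simp only [hτ] at this
    linarith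

end GenBeta

/-! ### Odd `s` with a partly filled last row -/

namespace GenBeta

open Finset

variable {m s T R p : ℕ} {b : ℕ → ℕ → ℤ}

/-- The numerical estimate behind `Shape.lt_oddMax_of_last_row`. -/
theorem partial_last_row_estimate {T u w X P : ℤ} (hT : 1 ≤ T) (hu : 1 ≤ u) (huw : u ≤ w)
    (hP0 : 0 ≤ P) (hP : P ≤ 2 * u * (T - 1)) (hX0 : 0 ≤ X) (hXw : X ≤ w * T)
    (hXP : P - 2 * (T - 1) ≤ 2 * X) :
    2 * X * (T - P - u) <
      2 * u * T * ((w + 1) * T - u + 1) - P * ((w + 1) * T + 2 * u * T - T - u - P) := by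
  obtain ⟨v, rfl⟩ : ∃ v, u = v + 1 := ⟨u - 1, by ring⟩
  obtain ⟨q, rfl⟩ : ∃ q, w = v + 1 + q := ⟨w - (v + 1), by ring⟩
  have hv : 0 ≤ v := by linarith
  have hq : 0 ≤ q := by linarith
  -- The left side is linear in `X` with slope `2(T - P - u)`: a nonnegative slope calls for the
  -- upper bound on `X`, a negative one for a lower bound.
  rcases le_total (P + (v + 1)) T with h | h
  · obtain ⟨x, rfl⟩ : ∃ x, T = P + (v + 1) + x := ⟨T - (P + (v + 1)), by ring⟩
    have hx : 0 ≤ x := by linarith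
    have h1 : 2 * X * (P + (v + 1) + x - P - (v + 1)) ≤
        2 * ((v + 1 + q) * (P + (v + 1) + x)) * x := by
      have := mul_le_mul_of_nonneg_right hXw hx
      linarith
    refine h1.trans_lt (sub_pos.1 ?_)
    ring_nf
    positivity
  · obtain ⟨R, rfl⟩ : ∃ R, T = R + 1 := ⟨T - 1, by ring⟩
    have hR : 0 ≤ R := by linarith
    have hP' : P ≤ 2 * (v + 1) * R := by linarith
    -- The better lower bound on `X` is `0` when `P ≤ 2(T-1)`, and `(P - 2(T-1))/2` beyond that.
    rcases le_total P (2 * R) with h2 | h2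
    · have h1 : 2 * X * (R + 1 - P - (v + 1)) ≤ 0 :=
        mul_nonpos_of_nonneg_of_nonpos (by linarith) (by linarith)
      refine h1.trans_lt ?_
      obtain ⟨z, hz⟩ : ∃ z, P = 2 * R - z := ⟨2 * R - P, by ring⟩
      have hz0 : 0 ≤ z := by linarith
      have e1 : 0 ≤ q * (1 + R) * (2 * (1 + R) * (1 + v) - P) := by
        refine mul_nonneg (by positivity) ?_
        nlinarith [mul_nonneg hR hv]
      have e2 : 0 ≤ v * (4 - 2 * P + 10 * R - 3 * R * P + 6 * R ^ 2) := by
        refine mul_nonneg hv ?_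
        nlinarith [mul_nonneg hR hz0]
      have e3 : 0 < 4 - 2 * P + P ^ 2 + 8 * R - 3 * R * P + 4 * R ^ 2 := by
        nlinarith [sq_nonneg (z - R), sq_nonneg z, sq_nonneg R]
      nlinarith [mul_nonneg (sq_nonneg v) hR, mul_nonneg (sq_nonneg v) (sq_nonneg R)]
    · obtain ⟨x, rfl⟩ : ∃ x, P = 2 * R + x := ⟨P - 2 * R, by ring⟩
      have hx : 0 ≤ x := by linarith
      have hx' : x ≤ 2 * v * R := by linarith
      have h1 : 2 * X * (R + 1 - (2 * R + x) - (v + 1)) ≤ x * (R + 1 - (2 * R + x) - (v + 1)) :=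
        mul_le_mul_of_nonpos_right (by linarith) (by linarith)
      refine h1.trans_lt (sub_pos.1 ?_)
      have e1 : 0 ≤ q * (1 + R) * (2 + 2 * v + 2 * R * v - x) :=
        mul_nonneg (by positivity) (by linarith)
      have e2 : 0 ≤ v * (2 * v * R - x) := mul_nonneg hv (by linarith)
      have e3 : 0 ≤ 2 * x ^ 2 - 3 * R * x * v + 2 * R ^ 2 * v ^ 2 := by
        nlinarith [sq_nonneg (x - R * v), sq_nonneg (x + R * v), sq_nonneg x, sq_nonneg (R * v),
          mul_nonneg hx (mul_nonneg hR hv)]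
      have e4 : 0 ≤ (2 * R - 2) * x + 2 * R ^ 2 := by
        rcases hR.eq_or_lt with h | h
        · subst h
          have : x = 0 := by linarith
          simp [this]
        · have : 0 ≤ (2 * R - 2) * x := mul_nonneg (by linarith [Int.add_one_le_of_lt h]) hx
          positivity
      have e5 := mul_nonneg hR hv
      nlinarith

/-- The bound for odd `s` when the last row is neither empty nor completely nonempty. -/
theorem Shape.lt_oddMax_of_last_row (h : Shape m (2 * T + 1) T R p b) (hR : R + 1 = T)
    (hp : 0 < p) : 3 * arrayGain m (2 * T + 1) T b < oddMax m T := by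
  have hpm := h.p_lt
  obtain ⟨w, rfl⟩ : ∃ w, m = w + 1 := ⟨m - 1, by omega⟩
  obtain ⟨u, hu⟩ : ∃ u, w + 1 = p + u := Nat.exists_eq_add_of_le hpm.le
  subst hR
  set e : ℕ → ℕ → ℤ := fun r k => 2 * (R + 1) - 2 * r - b r k with he
  -- Columns from `p` on end in an empty block, so deficiencies can exceed one and need not be
  -- monotone into the last row. The truncation `C` is a monotone `0`-`1`-array, to which the grid
  -- inequality applies; the excess `P` lives on columns `≥ p`.
  set C : ℕ → ℕ → ℤ := fun r k => min (e r k) 1 with hC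
  set P : ℕ → ℕ → ℤ := fun r k => max (e r k - 1) 0 with hP
  have eCP : ∀ r k, e r k = C r k + P r k := fun r k => by
    simp only [hC, hP]; rcases le_total (e r k) 1 with h | h
    · rw [min_eq_left h, max_eq_right (by linarith)]; ring
    · rw [min_eq_right h, max_eq_left (by linarith)]; ring
  have P0 : ∀ r k, 0 ≤ P r k := fun r k => le_max_right _ _
  have C1 : ∀ r k, C r k ≤ 1 := fun r k => min_le_right _ _
  have e0 : ∀ r < R + 1, ∀ k < w + 1, 0 ≤ e r k := fun r hr k hk => by
    rcases Nat.lt_or_ge k w with h1 | h1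
    · have := h.cap r k hr (by omega)
      simp only [he]; push_cast at this; linarith
    · have := h.cap_last r hr
      rw [Nat.add_sub_cancel] at this
      rw [show k = w by omega]
      simp only [he]; push_cast at this; linarith
  have ew : ∀ r < R + 1, 1 ≤ e r w := fun r hr => by
    have := h.cap_last r hr
    rw [Nat.add_sub_cancel] at this
    simp only [he]; push_cast at this; linarith
  have C0 : ∀ r < R + 1, ∀ k < w + 1, 0 ≤ C r k := fun r hr k hk =>
    le_min (e0 r hr k hk) zero_le_one
  have Cw : ∀ r < R + 1, C r w = 1 := fun r hr => min_eq_right (ew r hr)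
  have e_left : ∀ r < R + 1, ∀ k < p, e r k ≤ 1 := fun r hr k hk => by
    have := h.le_of_column (l := R) (hk.trans hpm) (fun i hi => by
      rcases hi.eq_or_lt with rfl | hi
      · exact h.pos_last k hk
      · exact h.pos i k hi (hk.trans hpm)) (Nat.lt_succ_iff.1 hr)
    simp only [he]; linarith
  have P_left : ∀ r < R + 1, ∀ k < p, P r k = 0 := fun r hr k hk =>
    max_eq_right (by linarith [e_left r hr k hk])
  have e_R : ∀ k, p ≤ k → k < w + 1 → e R k = 2 := fun k hk hk' => by
    simp only [he]; rw [h.zero_last k hk hk']; ring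
  have P_R : ∀ k, p ≤ k → k < w + 1 → P R k = 1 := fun k hk hk' => by
    simp only [hP]; rw [e_R k hk hk']; norm_num
  have C_R : ∀ k, p ≤ k → k < w + 1 → C R k = 1 := fun k hk hk' => by
    simp only [hC]; rw [e_R k hk hk']; norm_num
  -- Row `R - 1` is nonempty, so climbing the column leaves deficiency at most `3`.
  have P_le : ∀ r < R, ∀ k < w + 1, P r k ≤ 2 := fun r hr k hk => by
    obtain ⟨l, rfl⟩ : ∃ l, R = l + 1 := ⟨R - 1, by omega⟩
    have := h.le_of_column (l := l) hk (fun i hi => h.pos i k (by omega) hk)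
      (Nat.lt_succ_iff.1 hr)
    refine max_le ?_ (by norm_num)
    simp only [he]; push_cast; linarith
  have e_row : ∀ r, ∀ k, k + 1 < w + 1 → e r k ≤ e r (k + 1) := fun r k hk => by
    have := h.row r k hk
    simp only [he]; linarith
  have e_col : ∀ r, r + 1 < R + 1 → ∀ k < w + 1, (r + 1 = R → k < p) → e r k ≤ e (r + 1) k :=
    fun r hr k hk hkp => by
      have := h.col_of_pos (r := r) (k := k) (by omega) hk hkp
      simp only [he]; push_cast; linarith
  -- The part `C`.
  have Ccol : ∀ r, r + 1 < R + 1 → ∀ k < w, C r k ≤ C (r + 1) k := fun r hr k hk => by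
    by_cases hrk : r + 1 = R → k < p
    · exact min_le_min_right _ (e_col r hr k (by omega) hrk)
    · push Not at hrk
      rw [hrk.1, C_R k hrk.2 (by omega)]
      exact C1 r k
  have Crow : ∀ r < R + 1, ∀ k, k + 1 < w → C r k ≤ C r (k + 1) := fun r _ k hk =>
    min_le_min_right _ (e_row r k (by omega))
  have CA := sum_centered_rows_nonneg Ccol
  have CB := sum_centered_cols_nonneg Crow
  have CX := mul_le_sum_centered_grid (fun r hr k hk => C0 r hr k (by omega))
    (fun r _ k _ => C1 r k) Ccol Crow
  set X := ∑ r ∈ range (R + 1), ∑ k ∈ range w, C r k with hX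
  set A := ∑ r ∈ range (R + 1), ∑ k ∈ range w, (2 * (r : ℤ) - ((R + 1 : ℕ) - 1)) * C r k
  set B := ∑ r ∈ range (R + 1), ∑ k ∈ range w, (2 * (k : ℤ) - (w - 1)) * C r k
  have X0 : 0 ≤ X := sum_nonneg fun r hr => sum_nonneg fun k hk =>
    C0 r (mem_range.1 hr) k (by have := mem_range.1 hk; omega)
  have Xw : X ≤ w * (R + 1) := by
    have : X ≤ ∑ r ∈ range (R + 1), ∑ k ∈ range w, (1 : ℤ) :=
      sum_le_sum fun r _ => sum_le_sum fun k _ => C1 r k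
    simp at this
    linarith
  -- The part `P`.
  set P' := ∑ r ∈ range R, ∑ j ∈ range u, P r (p + j) with hP'
  have splitP : ∀ c : ℕ → ℕ → ℤ, ∑ r ∈ range (R + 1), ∑ k ∈ range (w + 1), c r k * P r k =
      ∑ r ∈ range R, ∑ j ∈ range u, c r (p + j) * P r (p + j) + ∑ j ∈ range u, c R (p + j) :=
    fun c => by
      have h1 : ∀ r < R + 1, ∑ k ∈ range (w + 1), c r k * P r k =
          ∑ j ∈ range u, c r (p + j) * P r (p + j) := fun r hr => by
        rw [hu, sum_range_add, sum_eq_zero, zero_add]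
        intro k hk
        rw [P_left r hr k (mem_range.1 hk), mul_zero]
      rw [sum_range_succ, h1 R (Nat.lt_succ_self R), sum_congr rfl fun r hr =>
        h1 r (by have := mem_range.1 hr; omega)]
      congr 1
      refine sum_congr rfl fun j hj => ?_
      have := mem_range.1 hj
      rw [P_R _ (by omega) (by omega), mul_one]
  have P'0 : 0 ≤ P' := sum_nonneg fun r _ => sum_nonneg fun k _ => P0 _ _
  have P'le : P' ≤ 2 * u * R := by
    have : P' ≤ ∑ r ∈ range R, ∑ j ∈ range u, (2 : ℤ) :=
      sum_le_sum fun r hr => sum_le_sum fun j hj =>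
        P_le r (mem_range.1 hr) _ (by have := mem_range.1 hj; omega)
    simp at this
    linarith
  have hu0 : 0 < u := by omega
  -- Where `P` is positive, `C = 1` and `P ≤ 2`. Only the last column, not counted in `X`, is
  -- exempt; it contributes at most `2` per row.
  have XP' : P' - 2 * R ≤ 2 * X := by
    have h1 : P' ≤ ∑ r ∈ range R, (2 * ∑ k ∈ range w, C r k + 2) := by
      refine sum_le_sum fun r hr => ?_
      have hr' := mem_range.1 hr
      obtain ⟨u', rfl⟩ : ∃ u', u = u' + 1 := ⟨u - 1, by omega⟩
      rw [sum_range_succ]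
      have h2 := P_le r hr' (p + u') (by omega)
      have h3 : ∑ j ∈ range u', P r (p + j) ≤ 2 * ∑ j ∈ range u', C r (p + j) := by
        rw [mul_sum]
        refine sum_le_sum fun j hj => ?_
        have hj' : p + j < w + 1 := by have := mem_range.1 hj; omega
        have h4 := P_le r hr' _ hj'
        rcases le_or_gt (e r (p + j)) 1 with h5 | h5
        · have : P r (p + j) = 0 := max_eq_right (by linarith)
          rw [this]
          have := C0 r (by omega) _ hj'
          linarith
        · have : C r (p + j) = 1 := min_eq_right h5.le
          rw [this]; linarith
      have h6 : ∑ j ∈ range u', C r (p + j) ≤ ∑ k ∈ range w, C r k := by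
        rw [show w = p + u' by omega, sum_range_add]
        have : 0 ≤ ∑ k ∈ range p, C r k := sum_nonneg fun k hk =>
          C0 r (by omega) k (by have := mem_range.1 hk; omega)
        linarith
      linarith
    rw [sum_add_distrib, ← mul_sum] at h1
    rw [hX, sum_range_succ]
    have : 0 ≤ ∑ k ∈ range w, C R k := sum_nonneg fun k hk =>
      C0 R (by omega) k (by have := mem_range.1 hk; omega)
    simp at h1
    linarith
  have PA := sum_centered_rows_nonneg (e := fun r j => P r (p + j)) (G := R) (w := u)
    fun r hr j hj => max_le_max_right _
      (sub_le_sub_right (e_col r (by omega) _ (by omega) (by omega)) _)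
  have PB := sum_centered_cols_nonneg (e := fun r j => P r (p + j)) (G := R) (w := u)
    fun r _ j hj => max_le_max_right _ (sub_le_sub_right (e_row r _ (by omega)) _)
  set PA' := ∑ r ∈ range R, ∑ j ∈ range u, (2 * (r : ℤ) - (R - 1)) * P r (p + j)
  set PB' := ∑ r ∈ range R, ∑ j ∈ range u, (2 * (j : ℤ) - (u - 1)) * P r (p + j)
  -- The sums over `e`.
  have SP : ∑ r ∈ range (R + 1), ∑ k ∈ range (w + 1), P r k = P' + u := by
    have := splitP fun _ _ => 1
    simpa using this
  have S1 : ∑ r ∈ range (R + 1), ∑ k ∈ range (w + 1), e r k = X + (R + 1) + (P' + u) := by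
    rw [← SP, hX]
    simp only [eCP, sum_add_distrib]
    congr 1
    simp only [sum_range_succ (n := w), sum_add_distrib]
    rw [sum_congr rfl fun r hr => Cw r (mem_range.1 hr)]
    simp
  have Sw : ∑ r ∈ range (R + 1), e r w = (R + 1) + ∑ r ∈ range (R + 1), P r w := by
    simp only [eCP, sum_add_distrib]
    rw [sum_congr rfl fun r hr => Cw r (mem_range.1 hr)]
    simp
  have Pw : ∑ r ∈ range (R + 1), P r w ≤ P' + u := by
    rw [← SP]
    exact sum_le_sum fun r _ =>
      single_le_sum (f := fun k => P r k) (fun k _ => P0 r k) (mem_range.2 (Nat.lt_succ_self w))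
  -- Integrality: `e² ≥ e + 2P`, which for `e ≥ 2` reads `(e-1)(e-2) ≥ 0`.
  have S2 : X + (R + 1) + 3 * (P' + u) ≤ ∑ r ∈ range (R + 1), ∑ k ∈ range (w + 1), e r k ^ 2 := by
    have h1 : ∑ r ∈ range (R + 1), ∑ k ∈ range (w + 1), (e r k + 2 * P r k) ≤
        ∑ r ∈ range (R + 1), ∑ k ∈ range (w + 1), e r k ^ 2 :=
      sum_le_sum fun r hr => sum_le_sum fun k hk => by
        have h0 := e0 r (mem_range.1 hr) k (mem_range.1 hk)
        rcases le_or_gt (e r k) 1 with h5 | h5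
        · have : P r k = 0 := max_eq_right (by linarith)
          rw [this]
          rcases h0.eq_or_lt with h0 | h0
          · simp [← h0]
          · rw [show e r k = 1 by linarith]; norm_num
        · have : P r k = e r k - 1 := max_eq_left (by linarith)
          rw [this]
          nlinarith
    simp only [sum_add_distrib, ← mul_sum] at h1
    rw [S1, SP] at h1
    linarith
  have S3 : ∑ r ∈ range (R + 1), ∑ k ∈ range (w + 1),
      (2 * (r : ℤ) - ((R + 1 : ℕ) - 1)) * e r k = A + (PA' - P' + u * R) := by
    have h1 := splitP fun r _ => 2 * (r : ℤ) - ((R + 1 : ℕ) - 1)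
    have h2 : ∑ r ∈ range (R + 1), ∑ k ∈ range (w + 1),
        (2 * (r : ℤ) - ((R + 1 : ℕ) - 1)) * C r k = A := by
      have h3 : ∀ r ∈ range (R + 1), (2 * (r : ℤ) - ((R + 1 : ℕ) - 1)) * C r w =
          2 * (r : ℤ) - ((R + 1 : ℕ) - 1) := fun r hr => by
        rw [Cw r (mem_range.1 hr), mul_one]
      simp only [sum_range_succ (n := w), sum_add_distrib]
      rw [sum_congr rfl h3, sum_centered, add_zero]
    simp only [eCP, mul_add, sum_add_distrib]
    rw [h1, h2]
    congr 1
    have h3 : ∀ r j : ℕ, (2 * (r : ℤ) - ((R + 1 : ℕ) - 1)) * P r (p + j) =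
        (2 * (r : ℤ) - (R - 1)) * P r (p + j) - P r (p + j) := fun r j => by push_cast; ring
    simp only [h3, sum_sub_distrib]
    simp
    ring
  have S4 : ∑ r ∈ range (R + 1), ∑ k ∈ range (w + 1), (2 * (k : ℤ) - w) * e r k =
      (B - X + (R + 1) * w) + (PB' + p * P' + u * p) := by
    have h1 := splitP fun _ k => 2 * (k : ℤ) - w
    have h2 : ∑ r ∈ range (R + 1), ∑ k ∈ range (w + 1), (2 * (k : ℤ) - w) * C r k =
        B - X + (R + 1) * w := by
      have : ∀ r ∈ range (R + 1), ∑ k ∈ range (w + 1), (2 * (k : ℤ) - w) * C r k =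
          ∑ k ∈ range w, (2 * (k : ℤ) - (w - 1)) * C r k - ∑ k ∈ range w, C r k + w :=
        fun r hr => by
          rw [sum_range_succ, Cw r (mem_range.1 hr), ← sum_sub_distrib]
          congr 1
          · exact sum_congr rfl fun k _ => by ring
          · ring
      rw [sum_congr rfl this, sum_add_distrib, sum_sub_distrib]
      simp
      rfl
    have hwZ : (w : ℤ) = p + u - 1 := by
      have : (w : ℤ) + 1 = p + u := by exact_mod_cast hu
      linarith
    have h4 : ∑ r ∈ range R, ∑ j ∈ range u, (2 * ((p + j : ℕ) : ℤ) - w) * P r (p + j) =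
        PB' + p * P' := by
      have h3 : ∀ r j : ℕ, (2 * ((p + j : ℕ) : ℤ) - w) * P r (p + j) =
          (2 * (j : ℤ) - (u - 1)) * P r (p + j) + p * P r (p + j) := fun r j => by
        rw [hwZ]; push_cast; ring
      simp only [h3, sum_add_distrib]
      congr 1
      simp only [hP', mul_sum]
    have h5 : ∑ j ∈ range u, (2 * ((p + j : ℕ) : ℤ) - w) = u * p := by
      have h3 : ∀ j : ℕ, (2 * ((p + j : ℕ) : ℤ) - w) = (2 * (j : ℤ) - (u - 1)) + p := fun j => by
        rw [hwZ]; push_cast; ring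
      simp only [h3, sum_add_distrib, sum_centered]
      simp
    simp only [eCP, mul_add, sum_add_distrib]
    rw [h1, h2, h4, h5]
  have key := three_mul_arrayGain_odd w (R + 1) e
  have hbe : arrayGain (w + 1) (2 * (R + 1) + 1) (R + 1) b = arrayGain (w + 1) (2 * (R + 1) + 1)
      (R + 1) (fun r k => 2 * ((R + 1 : ℕ) : ℤ) - 2 * r - e r k) :=
    arrayGain_congr (Nat.succ_pos w) fun r _ k _ => by simp only [he]; push_cast; ring
  rw [hbe, key, S1, S3, S4, Sw]
  have est := partial_last_row_estimate (T := R + 1) (u := u) (w := w) (X := X) (P := P')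
    (by linarith [Int.natCast_nonneg R]) (by exact_mod_cast hu0) (by exact_mod_cast (by omega))
    P'0 (by linarith) X0 Xw (by linarith)
  have hpZ : (p : ℤ) = w + 1 - u := by
    have : (w : ℤ) + 1 = p + u := by exact_mod_cast hu
    linarith
  have c1 : 0 ≤ (2 * (w : ℤ) * (R + 1) + 2 * R + 4) * A := mul_nonneg (by positivity) CA
  have c2 : 0 ≤ ((R : ℤ) + 2) * B := mul_nonneg (by positivity) CB
  have c3 : 0 ≤ (((w : ℤ) + 1) * (2 * (R + 1) + 1) + 1) * PA' := mul_nonneg (by positivity) PA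
  have c4 : 0 ≤ (2 * ((R : ℤ) + 1) + 1) * PB' := mul_nonneg (by positivity) PB
  rw [hpZ]
  push_cast at *
  linarith

end GenBeta

/-! ### From sets of integers to arrays of blocks -/

namespace GenBeta

open Finset

/-- The residues modulo `s` of the elements of `S` in `[qs, (q+1)s)`. -/
def res (s : ℕ) (S : Finset ℕ) (q : ℕ) : Finset ℕ :=
  (range s).filter fun ρ => q * s + ρ ∈ S

variable {m s : ℕ} {S : Finset ℕ}

theorem mem_res {q ρ : ℕ} : ρ ∈ res s S q ↔ ρ < s ∧ q * s + ρ ∈ S := by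
  simp [res]

theorem block_succ_eq (q : ℕ) :
    block s S (q + 1) = (res s S q).map (addLeftEmbedding (q * s)) := by
  ext x
  simp only [block, mem_filter, mem_map, mem_res, addLeftEmbedding_apply, Nat.add_sub_cancel]
  constructor
  · rintro ⟨hx, h1, h2⟩
    rw [add_mul, one_mul] at h2
    exact ⟨x - q * s, ⟨by omega, by rwa [Nat.add_sub_cancel' h1]⟩, Nat.add_sub_cancel' h1⟩
  · rintro ⟨ρ, ⟨h1, h2⟩, rfl⟩
    exact ⟨h2, by omega, by rw [add_mul, one_mul]; omega⟩

theorem a_succ (q : ℕ) : a s S (q + 1) = (res s S q).card := by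
  rw [a, block_succ_eq, card_map]

theorem n_succ (q : ℕ) : n s S (q + 1) = (res s S q).sup id := by
  rw [n, block_succ_eq, sup_map]
  refine sup_congr rfl fun ρ hρ => ?_
  simp [Nat.mod_eq_of_lt (mem_res.1 hρ).1]

theorem ext_of_res (hs : 0 < s) {S' : Finset ℕ} (h : ∀ q, res s S q = res s S' q) : S = S' := by
  ext x
  have h1 : ∀ A : Finset ℕ, x ∈ A ↔ x % s ∈ res s A (x / s) := fun A => by
    rw [mem_res, mul_comm, Nat.div_add_mod]
    exact ⟨fun hx => ⟨Nat.mod_lt _ hs, hx⟩, fun hx => hx.2⟩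
  rw [h1 S, h1 S', h]

theorem sum_eq_sum_res (hs : 0 < s) {Q : ℕ} (hS : ∀ x ∈ S, x < Q * s) (g : ℕ → ℤ) :
    ∑ x ∈ S, g x = ∑ q ∈ range Q, ∑ ρ ∈ res s S q, g (q * s + ρ) := by
  have h1 : ∀ x ∈ S, x / s ∈ range Q := fun x hx => by
    rw [mem_range, Nat.div_lt_iff_lt_mul hs]; exact hS x hx
  rw [← sum_fiberwise_of_maps_to h1]
  refine sum_congr rfl fun q _ => ?_
  have h2 : S.filter (fun x => x / s = q) = (res s S q).map (addLeftEmbedding (q * s)) := by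
    rw [← block_succ_eq, block]
    refine filter_congr fun x _ => ?_
    rw [Nat.add_sub_cancel, Nat.div_eq_iff hs]
    constructor
    · rintro ⟨h1, h2⟩
      exact ⟨h1, by rw [add_mul, one_mul]; omega⟩
    · rintro ⟨h1, h2⟩
      rw [add_mul, one_mul] at h2
      exact ⟨h1, by omega⟩
  rw [h2, sum_map]
  rfl

theorem sum_range_mul_eq (T m : ℕ) (f : ℕ → ℤ) :
    ∑ q ∈ range (T * m), f q = ∑ r ∈ range T, ∑ k ∈ range m, f (r * m + k) := by
  induction T with
  | zero => simp
  | succ T ih => rw [add_mul, one_mul, sum_range_add, ih, sum_range_succ]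

/-- The number of elements in the block in row `r` and column `k`. -/
def cnt (m s : ℕ) (S : Finset ℕ) (r k : ℕ) : ℤ := (res s S (r * m + k)).card

/-- One more than the largest admissible residue in row `r` and column `k`. -/
def top (m s r k : ℕ) : ℕ := s - r - if k + 1 = m then 1 else 0

theorem top_of_lt {r k : ℕ} (h : k + 1 < m) : top m s r k = s - r := by
  rw [top, if_neg h.ne, Nat.sub_zero]

theorem top_last {r k : ℕ} (h : k + 1 = m) : top m s r k = s - r - 1 := by
  rw [top, if_pos h]

/-- Division by `ms` reads off the row, and the bases lie in disjoint columns. Row `r` of a pyramid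
has lost `r` places at either end of its base. -/
theorem mul_add_mem_bigL (hm : 2 ≤ m) (hs : 2 ≤ s) {r k ρ : ℕ} (hk : k < m) (hρ : ρ < s) :
    (r * m + k) * s + ρ ∈ bigL m s ↔ r + 1 ≤ ρ ∧ ρ < top m s r k := by
  have hj : k * s + ρ < m * s := by
    have : (k + 1) * s ≤ m * s := Nat.mul_le_mul_right s hk
    rw [add_mul, one_mul] at this
    omega
  have hx : (r * m + k) * s + ρ = m * s * r + (k * s + ρ) := by ring
  have key : ∀ A B : ℕ, (r * m + k) * s + ρ ∈ pyramid (m * s) A B ↔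
      A + r ≤ k * s + ρ ∧ k * s + ρ + r ≤ B := by
    intro A B
    rw [hx]
    constructor
    · rintro ⟨i, j, hj', h1, h2, h3⟩
      have e1 : i = r := by
        have := congrArg (· / (m * s)) h3
        rw [Nat.mul_add_div (by omega), Nat.mul_add_div (by omega), Nat.div_eq_of_lt hj,
          Nat.div_eq_of_lt hj'] at this
        omega
      subst e1
      have e2 : k * s + ρ = j := by omega
      subst e2
      exact ⟨h1, h2⟩
    · rintro ⟨h1, h2⟩
      exact ⟨r, k * s + ρ, hj, h1, h2, rfl⟩
  have cmp : ∀ c, c * s + 1 + r ≤ k * s + ρ → k * s + ρ < (c + 1) * s → c = k := by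
    intro c h1 h2
    rcases lt_trichotomy c k with h | h | h
    · have : (c + 1) * s ≤ k * s := Nat.mul_le_mul_right s h
      omega
    · exact h
    · have : (k + 1) * s ≤ c * s := Nat.mul_le_mul_right s h
      rw [add_mul, one_mul] at this
      omega
  simp only [bigL, Set.mem_union, Set.mem_ofPred_eq, key]
  constructor
  · rintro (⟨c, h1, h2, h3, h4⟩ | ⟨h3, h4⟩)
    · obtain ⟨c, rfl⟩ : ∃ d, c = d + 1 := ⟨c - 1, by omega⟩
      rw [Nat.add_sub_cancel] at h3
      have hpos : 0 < (c + 1) * s := by positivity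
      obtain rfl := cmp c h3 (by omega)
      rw [top_of_lt (by omega)]
      rw [add_mul, one_mul] at h4
      omega
    · obtain ⟨c, rfl⟩ : ∃ d, m = d + 1 := ⟨m - 1, by omega⟩
      rw [Nat.add_sub_cancel] at h3
      have hpos : s ≤ (c + 1) * s := Nat.le_mul_of_pos_left s (Nat.succ_pos c)
      obtain rfl := cmp c h3 (by omega)
      rw [top_last rfl]
      rw [add_mul, one_mul] at h4
      omega
  · rintro ⟨h1, h2⟩
    rcases Nat.lt_or_ge (k + 1) m with h | h
    · rw [top_of_lt h] at h2
      refine Or.inl ⟨k + 1, by omega, by omega, ?_, ?_⟩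
      · rw [Nat.add_sub_cancel]; omega
      · rw [add_mul, one_mul]; omega
    · obtain rfl : k + 1 = m := by omega
      rw [top_last rfl] at h2
      refine Or.inr ⟨?_, ?_⟩
      · rw [Nat.add_sub_cancel]; omega
      · rw [add_mul, one_mul]; omega

theorem res_subset (hm : 2 ≤ m) (hs : 2 ≤ s) (hS : (S : Set ℕ) ⊆ bigL m s) {r k : ℕ}
    (hk : k < m) : res s S (r * m + k) ⊆ Ico (r + 1) (top m s r k) := fun ρ hρ => by
  have h := mem_res.1 hρ
  rw [mem_Ico]
  exact (mul_add_mem_bigL hm hs hk h.1).1 (hS h.2)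

theorem top_le {r k : ℕ} : top m s r k ≤ s - r := Nat.sub_le _ _

/-- A window `r + 1 ≤ ρ < s - r` is nonempty only if `r < s / 2`, so at most `s / 2` rows are
occupied. -/
theorem lt_of_mem (hm : 2 ≤ m) (hs : 2 ≤ s) (hS : (S : Set ℕ) ⊆ bigL m s) {x : ℕ} (hx : x ∈ S) :
    x < s / 2 * m * s := by
  have h1 : x % s ∈ res s S (x / s / m * m + x / s % m) := by
    rw [mem_res, Nat.div_add_mod', Nat.div_add_mod']
    exact ⟨Nat.mod_lt _ (by omega), hx⟩
  have h2 := mem_Ico.1 (res_subset hm hs hS (Nat.mod_lt _ (by omega)) h1)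
  have h3 := top_le (m := m) (s := s) (r := x / s / m) (k := x / s % m)
  have h4 : x / s / m < s / 2 := by omega
  rwa [Nat.div_lt_iff_lt_mul (by omega), Nat.div_lt_iff_lt_mul (by omega)] at h4

/-- Twice the size function, as an integer. -/
def twiceSize (S : Finset ℕ) : ℤ := 2 * ∑ x ∈ S, (x : ℤ) - (S.card : ℤ) ^ 2 + S.card

theorem two_mul_sizeCount : 2 * sizeCount S = twiceSize S := by
  rw [sizeCount, twiceSize]
  push_cast
  ring

/-- Twice the loss in the sum of a set `B` compared with the `|B|` largest numbers below `H`. -/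
def defect (B : Finset ℕ) (H : ℕ) : ℤ :=
  2 * B.card * H - (B.card : ℤ) ^ 2 - B.card - 2 * ∑ x ∈ B, (x : ℤ)

/-- Lower the ceiling one step at a time: a present top element can be removed at no cost, a missing
one costs `2|B|`. So zero defect means that no gap lies above an element. -/
theorem defect_nonneg_and {B : Finset ℕ} {H : ℕ} (hB : ∀ x ∈ B, x < H) :
    0 ≤ defect B H ∧ (defect B H = 0 → B = Ico (H - B.card) H) := by
  induction H generalizing B with
  | zero =>
    have : B = ∅ := eq_empty_of_forall_notMem fun x hx => absurd (hB x hx) (Nat.not_lt_zero x)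
    subst this
    simp [defect]
  | succ H ih =>
    by_cases hH : H ∈ B
    · have hc := card_erase_add_one hH
      have hsum := add_sum_erase B (fun x => (x : ℤ)) hH
      obtain ⟨h1, h2⟩ := ih (B := B.erase H) fun x hx => by
        have := hB x (mem_of_mem_erase hx)
        have := ne_of_mem_erase hx
        omega
      have h3 : defect B (H + 1) = defect (B.erase H) H := by
        rw [defect, defect, ← hc, ← hsum]
        push_cast; ring
      rw [h3]
      refine ⟨h1, fun h => ?_⟩
      rw [← insert_erase hH, card_insert_of_notMem (notMem_erase H B)]
      conv_lhs => rw [h2 h]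
      have : (B.erase H).card ≤ H := by
        have := congrArg card (h2 h)
        rw [Nat.card_Ico] at this
        omega
      ext x
      simp only [mem_insert, mem_Ico]
      omega
    · obtain ⟨h1, h2⟩ := ih (B := B) fun x hx => by
        have := hB x hx
        have : x ≠ H := fun h => hH (h ▸ hx)
        omega
      have h3 : defect B (H + 1) = defect B H + 2 * B.card := by
        rw [defect, defect]; push_cast; ring
      rw [h3]
      refine ⟨by positivity, fun h => ?_⟩
      have : B.card = 0 := by
        have : (0 : ℤ) ≤ B.card := by positivity
        have : (B.card : ℤ) = 0 := by linarith
        exact_mod_cast this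
      rw [card_eq_zero.1 this]
      simp

theorem defect_Ico {l H : ℕ} : defect (Ico l H) H = 0 := by
  induction H with
  | zero => simp [defect]
  | succ H ih =>
    rcases Nat.lt_or_ge H l with h | h
    · rw [Ico_eq_empty (by omega)]; simp [defect]
    · rw [defect] at *
      rw [sum_Ico_succ_top h]
      rw [Nat.card_Ico] at *
      rw [Nat.succ_sub h]
      push_cast [Nat.cast_sub h] at *
      linarith

theorem defect_add (B : Finset ℕ) (H j : ℕ) : defect B (H + j) = defect B H + 2 * j * B.card := by
  rw [defect, defect]; push_cast; ring

/-- The size of a set in terms of the array of its block sizes and the defects of its blocks. -/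
theorem twiceSize_eq (hm : 2 ≤ m) (hs : 2 ≤ s) (hS : (S : Set ℕ) ⊆ bigL m s) :
    twiceSize S = arrayGain m s (s / 2) (cnt m s S) -
      ∑ r ∈ range (s / 2), ∑ k ∈ range m, defect (res s S (r * m + k)) (top m s r k) := by
  have h0 : ∀ x ∈ S, x < s / 2 * m * s := fun x hx => lt_of_mem hm hs hS hx
  have h1 := sum_eq_sum_res (by omega) h0 fun x => (x : ℤ)
  have h2 := sum_eq_sum_res (by omega) h0 fun _ => (1 : ℤ)
  rw [sum_range_mul_eq] at h1 h2
  have h3 : (S.card : ℤ) = ∑ r ∈ range (s / 2), ∑ k ∈ range m, cnt m s S r k := by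
    simpa [cnt] using h2
  obtain ⟨w, rfl⟩ : ∃ w, m = w + 1 := ⟨m - 1, by omega⟩
  have h4 : ∀ r ∈ range (s / 2),
      ∑ k ∈ range (w + 1), defect (res s S (r * (w + 1) + k)) (top (w + 1) s r k) =
      ∑ k ∈ range (w + 1), blockGain (w + 1) s r k (cnt (w + 1) s S r k) - 2 * cnt (w + 1) s S r w
        - 2 * ∑ k ∈ range (w + 1), ∑ ρ ∈ res s S (r * (w + 1) + k),
          (((r * (w + 1) + k) * s + ρ : ℕ) : ℤ) := by
    intro r hr
    have hr' : r < s / 2 := mem_range.1 hr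
    -- `blockGain` assumes the ceiling `H = s - r`. In the last column the ceiling is one lower,
    -- which yields the extra `-2 * cnt`.
    have aux : ∀ k, ∀ H : ℕ, defect (res s S (r * (w + 1) + k)) H =
        blockGain (w + 1) s r k (cnt (w + 1) s S r k)
        - 2 * (s - r - H) * cnt (w + 1) s S r k
        - 2 * ∑ ρ ∈ res s S (r * (w + 1) + k), (((r * (w + 1) + k) * s + ρ : ℕ) : ℤ) := by
      intro k H
      rw [defect, blockGain, cnt]
      push_cast
      rw [sum_add_distrib, sum_const, nsmul_eq_mul]
      ring
    have aux1 : ∀ k ∈ range w, defect (res s S (r * (w + 1) + k)) (top (w + 1) s r k) =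
        blockGain (w + 1) s r k (cnt (w + 1) s S r k)
        - 2 * ∑ ρ ∈ res s S (r * (w + 1) + k), (((r * (w + 1) + k) * s + ρ : ℕ) : ℤ) :=
      fun k hk => by
        have := mem_range.1 hk
        rw [aux, top_of_lt (by omega), Nat.cast_sub (by omega)]
        ring
    have aux2 : defect (res s S (r * (w + 1) + w)) (top (w + 1) s r w) =
        blockGain (w + 1) s r w (cnt (w + 1) s S r w) - 2 * cnt (w + 1) s S r w
        - 2 * ∑ ρ ∈ res s S (r * (w + 1) + w), (((r * (w + 1) + w) * s + ρ : ℕ) : ℤ) := by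
      rw [aux, top_last rfl, Nat.cast_sub (by omega), Nat.cast_sub (by omega)]
      push_cast
      ring
    rw [sum_range_succ, sum_congr rfl aux1, aux2, sum_sub_distrib, ← mul_sum,
      sum_range_succ _ w, sum_range_succ _ w]
    ring
  rw [sum_congr rfl h4, twiceSize, h1, h3, arrayGain, Nat.add_sub_cancel, sum_sub_distrib,
    sum_sub_distrib, ← mul_sum, ← mul_sum]
  ring

end GenBeta

/-! ### Generalized-β-sets give arrays with a shape -/

namespace GenBeta

open Finset

variable {m s : ℕ} {S : Finset ℕ}

/-- Condition 1 therefore reaches all consecutive blocks in the rows that can be occupied. -/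
theorem ceil_half (hs : 2 ≤ s) : ⌈((s : ℚ) - 1) / 2⌉₊ = s / 2 := by
  rw [Nat.ceil_eq_iff (by omega)]
  have h1 : 2 * (s / 2) ≤ s := by omega
  have h2 : s ≤ 2 * (s / 2) + 1 := by omega
  have h3 : ((s / 2 - 1 : ℕ) : ℚ) = ((s / 2 : ℕ) : ℚ) - 1 := by
    rw [Nat.cast_sub (by omega)]; simp
  have h1' : 2 * ((s / 2 : ℕ) : ℚ) ≤ s := by exact_mod_cast h1
  have h2' : (s : ℚ) ≤ 2 * ((s / 2 : ℕ) : ℚ) + 1 := by exact_mod_cast h2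
  rw [h3]
  constructor <;> linarith

theorem numRows_spec (hm : 0 < m) (hs : 0 < s) (S : Finset ℕ) :
    1 ≤ numRows m s S ∧ ∀ x ∈ S, x < numRows m s S * (m * s) := by
  refine Nat.sInf_mem (s := {i : ℕ | 1 ≤ i ∧ ∀ x ∈ S, x < i * (m * s)})
    ⟨S.sup id + 1, by omega, fun x hx => ?_⟩
  have h1 : x ≤ S.sup id := le_sup (f := id) hx
  have h2 : 0 < m * s := by positivity
  nlinarith

/-- The conditions are stated only up to row `t`; this makes them available whenever the later block
involved is nonempty. -/
theorem lt_numRows (hm : 0 < m) (hs : 0 < s) {r k : ℕ}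
    (h : 0 < (res s S (r * m + k)).card) : r < numRows m s S := by
  obtain ⟨ρ, hρ⟩ := card_pos.1 h
  have h1 := (numRows_spec hm hs S).2 _ (mem_res.1 hρ).2
  rw [← mul_assoc] at h1
  by_contra hc
  have h2 : numRows m s S * m * s ≤ (r * m + k) * s := by
    refine Nat.mul_le_mul_right s ?_
    have := Nat.mul_le_mul_right m (not_lt.1 hc)
    omega
  omega

theorem IsGenBetaSet.cnt_row (h : IsGenBetaSet m s S) (hm : 2 ≤ m) (hs : 2 ≤ s) (r : ℕ) {k : ℕ}
    (hk : k + 1 < m) : cnt m s S r (k + 1) ≤ cnt m s S r k := by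
  rw [cnt, cnt, Nat.cast_le]
  rcases Nat.eq_zero_or_pos (res s S (r * m + (k + 1))).card with h0 | h0
  · omega
  have h1 := lt_numRows (by omega) (by omega) h0
  have h2 : (r + 1) * m ≤ numRows m s S * m := Nat.mul_le_mul_right m h1
  rw [add_mul, one_mul] at h2
  have := h.cond2 (r * m + k + 1) (by omega) (by omega) fun hd => by
    rw [add_assoc, Nat.dvd_add_right (Dvd.intro_left r rfl)] at hd
    exact absurd (Nat.le_of_dvd (by omega) hd) (by omega)
  rwa [a_succ, a_succ] at this

theorem IsGenBetaSet.cnt_col (h : IsGenBetaSet m s S) (hm : 2 ≤ m) (hs : 2 ≤ s) (r : ℕ) {k : ℕ}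
    (hk : k < m) (h0 : 0 < cnt m s S (r + 1) k) :
    cnt m s S (r + 1) k + 2 ≤ cnt m s S r k := by
  rw [cnt, Int.natCast_pos] at h0
  have h1 := lt_numRows (by omega) (by omega) h0
  have h2 : (r + 1) * m ≤ (numRows m s S - 1) * m := Nat.mul_le_mul_right m (by omega)
  rw [add_mul, one_mul] at h2
  have e : (r + 1) * m + k = r * m + k + m := by ring
  have := h.cond3 (r * m + k + 1) (by omega) (by omega)
  rw [show r * m + k + 1 + m = r * m + k + m + 1 by ring, a_succ, a_succ, ← e] at this
  rw [cnt, cnt]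
  exact_mod_cast this h0

theorem cnt_le (hm : 2 ≤ m) (hs : 2 ≤ s) (hS : (S : Set ℕ) ⊆ bigL m s) {r k : ℕ}
    (hk : k < m) : cnt m s S r k ≤ ((top m s r k - (r + 1) : ℕ) : ℤ) := by
  rw [cnt, Nat.cast_le, ← Nat.card_Ico]
  exact card_le_card (res_subset hm hs hS hk)

theorem IsGenBetaSet.exists_shape (h : IsGenBetaSet m s S) (hm : 2 ≤ m) (hs : 2 ≤ s) :
    ∃ R p, Shape m s (s / 2) R p (cnt m s S) := by
  have hm0 : 0 < m := by omega
  have hbig : ∀ q, s / 2 * m ≤ q → (res s S q).card = 0 := fun q hq => by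
    rw [card_eq_zero]
    refine eq_empty_of_forall_notMem fun ρ hρ => ?_
    have h1 := lt_of_mem hm hs h.subset (mem_res.1 hρ).2
    have h2 := Nat.mul_le_mul_right s hq
    omega
  have hex : ∃ q, (res s S q).card = 0 := ⟨_, hbig _ le_rfl⟩
  -- The first empty block. Condition 1 propagates emptiness from there on, so `R` and `p` are the
  -- quotient and remainder of `N` by `m`.
  set N := Nat.find hex with hN
  have hpos : ∀ q < N, 0 < (res s S q).card := fun q hq =>
    Nat.pos_of_ne_zero (Nat.find_min hex hq)
  have hzero : ∀ q, N ≤ q → (res s S q).card = 0 := fun q hq => by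
    induction q, hq using Nat.le_induction with
    | base => exact Nat.find_spec hex
    | succ q _ ih =>
      rcases Nat.lt_or_ge (q + 1) (s / 2 * m) with h1 | h1
      · have := h.cond1 (q + 1) (by omega) (by rwa [ceil_half hs])
        rw [a_succ, a_succ] at this
        exact this ih
      · exact hbig _ h1
  have hNle : N ≤ s / 2 * m := Nat.find_min' hex (hbig _ le_rfl)
  have hN0 : 0 < N := by
    obtain ⟨x, hx⟩ := h.nonempty
    by_contra hc
    have h1 := hzero (x / s) ((Nat.eq_zero_of_not_pos hc).trans_le (Nat.zero_le _))
    have h2 : x % s ∈ res s S (x / s) := by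
      rw [mem_res, Nat.div_add_mod']
      exact ⟨Nat.mod_lt _ (by omega), hx⟩
    rw [card_eq_zero.1 h1] at h2
    simp at h2
  have hdm := Nat.div_add_mod' N m
  have hml := Nat.mod_lt N hm0
  refine ⟨N / m, N % m, hml, by omega, by omega, fun r k hr hk => ?_, fun k hk => ?_,
    fun k hk hk' => ?_, fun r k hr hk => ?_, fun r k hk => h.cnt_row hm hs r hk,
    fun r k hk h0 => h.cnt_col hm hs r hk h0, fun r k hr hk => ?_, fun r hr => ?_⟩
  · rw [cnt, Int.natCast_pos]
    refine hpos _ ?_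
    have := Nat.mul_le_mul_right m hr
    rw [Nat.succ_mul] at this
    omega
  · rw [cnt, Int.natCast_pos]
    exact hpos _ (by omega)
  · rw [cnt, Int.natCast_eq_zero]
    exact hzero _ (by omega)
  · rw [cnt, Int.natCast_eq_zero]
    refine hzero _ ?_
    have := Nat.mul_le_mul_right m hr
    rw [Nat.succ_mul] at this
    omega
  · have := cnt_le hm hs h.subset (r := r) (k := k) (by omega)
    rw [top_of_lt hk] at this
    omega
  · have := cnt_le hm hs h.subset (r := r) (k := m - 1) (by omega)
    rw [top_last (by omega)] at this
    omega

theorem IsGenBetaSet.defect_nonneg (h : IsGenBetaSet m s S) (hm : 2 ≤ m) (hs : 2 ≤ s) {r k : ℕ}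
    (hk : k < m) : 0 ≤ defect (res s S (r * m + k)) (top m s r k) :=
  (defect_nonneg_and fun _ hx => (mem_Ico.1 (res_subset hm hs h.subset hk hx)).2).1

theorem IsGenBetaSet.twiceSize_le (h : IsGenBetaSet m s S) (hm : 2 ≤ m) (hs : 2 ≤ s) :
    twiceSize S ≤ arrayGain m s (s / 2) (cnt m s S) := by
  rw [twiceSize_eq hm hs h.subset]
  have := sum_nonneg fun r (_ : r ∈ range (s / 2)) => sum_nonneg fun k hk =>
    h.defect_nonneg hm hs (r := r) (k := k) (mem_range.1 hk)
  linarith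

/-- Blocks of equal size in a row have the same largest residue as the last block of the row. -/
theorem IsGenBetaSet.lt_of_tie (h : IsGenBetaSet m s S) (hm : 2 ≤ m) (hs : 2 ≤ s) {r k : ℕ}
    (hk : k < m) (htie : cnt m s S r k = cnt m s S r (m - 1)) :
    ∀ ρ ∈ res s S (r * m + k), ρ < s - r - 1 := by
  -- Induction leftwards from the last column, whose window lacks the residue `s - r - 1`. Sizes
  -- between two equal ones in a row are equal, so condition 5 passes the largest residue along.
  obtain ⟨j, hj⟩ : ∃ j, m - 1 = k + j := ⟨m - 1 - k, by omega⟩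
  induction j generalizing k with
  | zero =>
    intro ρ hρ
    have := (mem_Ico.1 (res_subset hm hs h.subset hk hρ)).2
    rwa [top_last (by omega)] at this
  | succ j ih =>
    intro ρ hρ
    have h1 := h.cnt_row hm hs r (k := k) (by omega)
    have h2 : cnt m s S r (m - 1) ≤ cnt m s S r (k + 1) := by
      have := le_of_antitone_range (z := cnt m s S r) (G := m)
        (fun i hi => h.cnt_row hm hs r hi) (i := k + 1) (j := m - 1) (by omega) (by omega)
      exact this
    have h3 := ih (k := k + 1) (by omega) (by omega) (by omega)
    have h4 : cnt m s S r k = cnt m s S r (k + 1) := by omega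
    have hpos : 0 < (res s S (r * m + (k + 1))).card := by
      have h5 : 0 < (res s S (r * m + k)).card := card_pos.2 ⟨ρ, hρ⟩
      rw [cnt, cnt, Nat.cast_inj] at h4
      omega
    have h5 := lt_numRows (by omega) (by omega) hpos
    have h6 : (r + 1) * m ≤ numRows m s S * m := Nat.mul_le_mul_right m h5
    rw [add_mul, one_mul] at h6
    have h7 := h.cond5 (r * m + k + 1) (by omega) (by omega) fun hd => by
      rw [add_assoc, Nat.dvd_add_right (Dvd.intro_left r rfl)] at hd
      exact absurd (Nat.le_of_dvd (by omega) hd) (by omega)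
    rw [a_succ, a_succ, n_succ, n_succ, add_assoc] at h7
    rw [cnt, cnt, Nat.cast_inj] at h4
    have h8 := h7 h4 hpos
    have h9 : ρ ≤ (res s S (r * m + k)).sup id := le_sup (f := id) hρ
    rw [h8] at h9
    refine h9.trans_lt ((Finset.sup_lt_iff ?_).2 h3)
    obtain ⟨σ, hσ⟩ := card_pos.1 hpos
    have := h3 σ hσ
    exact lt_of_le_of_lt (Nat.zero_le _) this

end GenBeta

/-! ### Sets whose blocks are intervals with prescribed margins -/

namespace GenBeta

open Finset

variable {m s : ℕ} {α β : ℕ → ℕ}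

/-- The set whose block in row `r` and column `k` consists of all residues from `r + 1 + α k`
to `s - r - β k - 1`. -/
def packed (m s : ℕ) (α β : ℕ → ℕ) : Finset ℕ :=
  (range (s / 2 * m * s)).filter fun x =>
    x / s / m + 1 + α (x / s % m) ≤ x % s ∧ x % s + x / s / m + β (x / s % m) < s

theorem res_packed {r k : ℕ} (hk : k < m) :
    res s (packed m s α β) (r * m + k) = Ico (r + 1 + α k) (s - r - β k) := by
  ext ρ
  simp only [mem_res, packed, mem_filter, mem_range, mem_Ico]
  have key : ρ < s → ((r * m + k) * s + ρ) / s = r * m + k ∧ ((r * m + k) * s + ρ) % s = ρ ∧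
      (r * m + k) / m = r ∧ (r * m + k) % m = k := fun hρ => by
    refine ⟨?_, ?_, ?_, ?_⟩
    · rw [mul_comm, Nat.mul_add_div (by omega), Nat.div_eq_of_lt hρ, add_zero]
    · rw [mul_comm, Nat.mul_add_mod, Nat.mod_eq_of_lt hρ]
    · rw [mul_comm, Nat.mul_add_div (by omega), Nat.div_eq_of_lt hk, add_zero]
    · rw [mul_comm, Nat.mul_add_mod, Nat.mod_eq_of_lt hk]
  constructor
  · rintro ⟨h1, -, h2⟩
    obtain ⟨e1, e2, e3, e4⟩ := key h1
    rw [e1, e2, e3, e4] at h2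
    omega
  · intro h
    have h1 : ρ < s := by omega
    obtain ⟨e1, e2, e3, e4⟩ := key h1
    rw [e1, e2, e3, e4]
    refine ⟨h1, ?_, by omega, by omega⟩
    have h2 : (r * m + k + 1) * s ≤ s / 2 * m * s := by
      refine Nat.mul_le_mul_right s ?_
      have := Nat.mul_le_mul_right m (show r + 1 ≤ s / 2 by omega)
      rw [add_mul, one_mul] at this
      omega
    rw [add_mul _ 1, one_mul] at h2
    omega

theorem a_packed {r k : ℕ} (hk : k < m) :
    a s (packed m s α β) (r * m + k + 1) = s - r - β k - (r + 1 + α k) := by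
  rw [a_succ, res_packed hk, Nat.card_Ico]

theorem n_packed {r k : ℕ} (hk : k < m) (h : 0 < a s (packed m s α β) (r * m + k + 1)) :
    n s (packed m s α β) (r * m + k + 1) = s - r - β k - 1 := by
  rw [a_packed hk] at h
  rw [n_succ, res_packed hk]
  refine le_antisymm (Finset.sup_le fun x hx => ?_) ?_
  · have := mem_Ico.1 hx
    simp only [id]
    omega
  · exact le_sup (f := id) (mem_Ico.2 (by omega : _ ∧ s - r - β k - 1 < _))

theorem exists_row_column {i : ℕ} (hm : 0 < m) (hi : 1 ≤ i) : ∃ r k, k < m ∧ i = r * m + k + 1 :=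
  ⟨(i - 1) / m, (i - 1) % m, Nat.mod_lt _ hm, by rw [Nat.div_add_mod']; omega⟩

theorem exists_row_column_of_not_dvd {i : ℕ} (hm : 0 < m) (hi : 1 ≤ i) (hd : ¬ m ∣ i) :
    ∃ r k, k + 1 < m ∧ i = r * m + k + 1 := by
  obtain ⟨r, k, hk, rfl⟩ := exists_row_column hm hi
  refine ⟨r, k, lt_of_le_of_ne hk fun h => hd ⟨r + 1, ?_⟩, rfl⟩
  rw [add_assoc, h]
  ring

/-- Conditions on the margins `α`, `β` under which `packed m s α β` is a generalized-`β`-set. -/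
structure IsMargin (m s : ℕ) (α β : ℕ → ℕ) : Prop where
  last : 1 ≤ β (m - 1)
  mono : ∀ k, k + 1 < m → α k + β k ≤ α (k + 1) + β (k + 1)
  mono_right : ∀ k, k + 1 < m → β k ≤ β (k + 1)
  tie : ∀ k, k + 1 < m → α k + β k = α (k + 1) + β (k + 1) → β k = β (k + 1)
  last_le : α (m - 1) + β (m - 1) ≤ α 0 + β 0 + 2
  le : ∀ k, k + 1 < m → 2 * (s / 2) + (α k + β k) ≤ s
  le_last : 2 * (s / 2) + (α (m - 1) + β (m - 1)) ≤ s + 2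

theorem packed_subset (hm : 2 ≤ m) (hs : 2 ≤ s) (hβ : 1 ≤ β (m - 1)) :
    (packed m s α β : Set ℕ) ⊆ bigL m s := fun x hx => by
  have hk : x / s % m < m := Nat.mod_lt _ (by omega)
  have hρ : x % s < s := Nat.mod_lt _ (by omega)
  have hx' : (x / s / m * m + x / s % m) * s + x % s = x := by
    rw [Nat.div_add_mod', Nat.div_add_mod']
  rw [← hx', mul_add_mem_bigL hm hs hk hρ]
  have h := (mem_filter.1 (mem_coe.1 hx)).2
  rcases Nat.lt_or_ge (x / s % m + 1) m with h1 | h1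
  · rw [top_of_lt h1]
    omega
  · have h2 : x / s % m = m - 1 := by omega
    rw [top_last (by omega)]
    rw [h2] at h
    omega

theorem IsMargin.a_pos (h : IsMargin m s α β) {r k : ℕ} (hr : r < s / 2)
    (hk : k < m) (hrk : r + 1 = s / 2 → k + 1 < m) :
    0 < a s (packed m s α β) (r * m + k + 1) := by
  rw [a_packed hk]
  rcases Nat.lt_or_ge (k + 1) m with h1 | h1
  · have := h.le k h1
    omega
  · have h2 : k = m - 1 := by omega
    have := h.le_last
    rw [h2]
    omega

theorem IsMargin.numRows_packed (h : IsMargin m s α β) (hm : 2 ≤ m) (hs : 2 ≤ s) :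
    numRows m s (packed m s α β) = s / 2 := by
  refine le_antisymm (Nat.sInf_le ⟨by omega, fun x hx => ?_⟩) ?_
  · rw [← mul_assoc]
    exact mem_range.1 (mem_filter.1 hx).1
  · have h1 := h.a_pos (r := s / 2 - 1) (k := 0) (by omega) (by omega) (by omega)
    rw [a_succ] at h1
    have := lt_numRows (m := m) (r := s / 2 - 1) (k := 0) (by omega) (by omega) h1
    omega

theorem IsMargin.isGenBetaSet (h : IsMargin m s α β) (hm : 2 ≤ m) (hs : 2 ≤ s) :
    IsGenBetaSet m s (packed m s α β) := by
  have hN := h.numRows_packed hm hs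
  refine ⟨?_, packed_subset hm hs h.last, ?_, ?_, ?_, ?_, ?_, ?_⟩
  · have h1 := h.a_pos (r := 0) (k := 0) (by omega) (by omega) (by omega)
    rw [a_succ, card_pos] at h1
    obtain ⟨ρ, hρ⟩ := h1
    exact ⟨_, (mem_res.1 hρ).2⟩
  · intro i hi hlt h0
    rw [ceil_half hs] at hlt
    obtain ⟨r, k, hk, rfl⟩ := exists_row_column (m := m) (by omega) hi
    have hr : r < s / 2 := by
      by_contra hc
      have := Nat.mul_le_mul_right m (not_lt.1 hc)
      omega
    refine absurd (h.a_pos hr hk fun hr' => ?_) (by omega)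
    rw [← hr', add_mul, one_mul] at hlt
    omega
  · intro i hi _ hd
    obtain ⟨r, k, hk, rfl⟩ := exists_row_column_of_not_dvd (by omega) hi hd
    have := h.mono k hk
    rw [add_assoc (r * m), a_packed hk, ← add_assoc, a_packed (by omega)]
    omega
  · intro i hi _
    obtain ⟨r, k, hk, rfl⟩ := exists_row_column (m := m) (by omega) hi
    rw [show r * m + k + 1 + m = (r + 1) * m + k + 1 by ring, a_packed hk, a_packed hk]
    omega
  · intro i hi _ hd hpos
    obtain ⟨r, k, hk, rfl⟩ := exists_row_column_of_not_dvd (by omega) hi hd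
    have := h.mono k hk
    have := h.mono_right k hk
    rw [add_assoc (r * m)] at hpos ⊢
    have hpos' : 0 < a s (packed m s α β) (r * m + k + 1) := by
      rw [a_packed hk] at hpos
      rw [a_packed (by omega)]
      omega
    rw [n_packed hk hpos, ← add_assoc, n_packed (by omega) hpos']
    omega
  · intro i hi _ hd heq hpos
    obtain ⟨r, k, hk, rfl⟩ := exists_row_column_of_not_dvd (by omega) hi hd
    have hpos' := hpos
    rw [← heq] at hpos'
    rw [n_packed (by omega) hpos']
    rw [a_packed (by omega)] at heq hpos'
    rw [add_assoc (r * m)] at hpos heq ⊢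
    rw [n_packed hk hpos]
    rw [a_packed hk] at heq
    have := h.tie k hk (by omega)
    omega
  · rw [hN]
    intro h2
    obtain ⟨G, hG⟩ : ∃ G, s / 2 = G + 2 := ⟨s / 2 - 2, by omega⟩
    -- Condition 6 compares the end of one row with the start of the next, where windows are two
    -- shorter; this is the `+ 2` in `last_le`.
    have := h.last_le
    have h3 := a_packed (s := s) (α := α) (β := β) (r := G + 1) (k := 0) (m := m) (by omega)
    have h4 := a_packed (s := s) (α := α) (β := β) (r := G) (k := m - 1) (m := m) (by omega)
    rw [show G * m + (m - 1) + 1 = (G + 1) * m by rw [add_mul]; omega] at h4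
    rw [hG, show G + 2 - 1 = G + 1 by omega, h4]
    rw [add_zero] at h3
    rw [h3]
    omega

end GenBeta

/-! ### The extremal sets and their sizes -/

namespace GenBeta

open Finset

variable {m s : ℕ} {α β : ℕ → ℕ}

/-- The indicator function of the last column. -/
def lastInd (m k : ℕ) : ℕ := if k + 1 = m then 1 else 0

theorem lastInd_of_lt {k : ℕ} (h : k + 1 < m) : lastInd m k = 0 := if_neg h.ne

theorem lastInd_sub_one (h : 0 < m) : lastInd m (m - 1) = 1 := if_pos (by omega)

theorem lastInd_mono {k : ℕ} (h : k + 1 < m) : lastInd m k ≤ lastInd m (k + 1) := by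
  rw [lastInd_of_lt h]
  exact Nat.zero_le _

theorem isMargin_zero_lastInd (hm : 0 < m) : IsMargin m s (fun _ => 0) (lastInd m) where
  last := (lastInd_sub_one hm).ge
  mono k hk := by simpa using lastInd_mono hk
  mono_right k hk := lastInd_mono hk
  tie k _ h := by simpa using h
  last_le := by rw [lastInd_sub_one hm]; omega
  le k hk := by rw [lastInd_of_lt hk]; omega
  le_last := by rw [lastInd_sub_one hm]; omega

theorem isMargin_lastInd_lastInd (hm : 0 < m) : IsMargin m s (lastInd m) (lastInd m) where
  last := (lastInd_sub_one hm).ge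
  mono k hk := by have := lastInd_mono hk; omega
  mono_right k hk := lastInd_mono hk
  tie k _ h := by omega
  last_le := by rw [lastInd_sub_one hm]; omega
  le k hk := by rw [lastInd_of_lt hk]; omega
  le_last := by rw [lastInd_sub_one hm]; omega

theorem isMargin_zero_one (hs : Odd s) : IsMargin m s (fun _ => 0) (fun _ => 1) where
  last := le_rfl
  mono _ _ := le_rfl
  mono_right _ _ := le_rfl
  tie _ _ _ := rfl
  last_le := by omega
  le _ _ := by obtain ⟨T, rfl⟩ := hs; omega
  le_last := by omega

theorem cnt_packed {r k : ℕ} (hk : k < m) :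
    cnt m s (packed m s α β) r k = ((s - r - β k - (r + 1 + α k) : ℕ) : ℤ) := by
  rw [cnt, res_packed hk, Nat.card_Ico]

theorem twiceSize_packed_lastInd (hm : 2 ≤ m) (hs : 2 ≤ s) :
    twiceSize (packed m s α (lastInd m)) =
      arrayGain m s (s / 2) (cnt m s (packed m s α (lastInd m))) := by
  rw [twiceSize_eq hm hs (packed_subset hm hs (lastInd_sub_one (by omega)).ge), sub_eq_self]
  refine sum_eq_zero fun r _ => sum_eq_zero fun k hk => ?_
  rw [res_packed (mem_range.1 hk)]
  exact defect_Ico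

theorem three_mul_twiceSize_zero_lastInd_even {T : ℕ} (hm : 2 ≤ m) (hT : 1 ≤ T) :
    3 * twiceSize (packed m (2 * T) (fun _ => 0) (lastInd m)) = evenMax m T := by
  obtain ⟨w, rfl⟩ : ∃ w, m = w + 1 := ⟨m - 1, by omega⟩
  obtain ⟨R, rfl⟩ : ∃ R, T = R + 1 := ⟨T - 1, by omega⟩
  rw [twiceSize_packed_lastInd hm (by omega), Nat.mul_div_cancel_left _ two_pos,
    three_mul_arrayGain_of_last_column w R fun _ => 0]
  · simp
  · intro r hr k hk
    rw [cnt_packed (by omega), lastInd_of_lt (by omega)]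
    omega
  · intro r hr
    rw [cnt_packed (by omega), lastInd, if_pos rfl]
    omega
  · rw [cnt_packed (by omega), lastInd, if_pos rfl]
    omega

theorem three_mul_twiceSize_lastInd_lastInd {T : ℕ} (hm : 2 ≤ m) (hT : 1 ≤ T) :
    3 * twiceSize (packed m (2 * T) (lastInd m) (lastInd m)) = evenMax m T := by
  obtain ⟨w, rfl⟩ : ∃ w, m = w + 1 := ⟨m - 1, by omega⟩
  obtain ⟨R, rfl⟩ : ∃ R, T = R + 1 := ⟨T - 1, by omega⟩
  rw [twiceSize_packed_lastInd hm (by omega), Nat.mul_div_cancel_left _ two_pos,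
    three_mul_arrayGain_of_last_column w R fun _ => 1]
  · simp only [mul_one, sum_centered]
    simp
  · intro r hr k hk
    rw [cnt_packed (by omega), lastInd_of_lt (by omega)]
    omega
  · intro r hr
    rw [cnt_packed (by omega), lastInd, if_pos rfl]
    omega
  · rw [cnt_packed (by omega), lastInd, if_pos rfl]
    omega

theorem three_mul_twiceSize_zero_lastInd_odd {T : ℕ} (hm : 2 ≤ m) (hT : 1 ≤ T) :
    3 * twiceSize (packed m (2 * T + 1) (fun _ => 0) (lastInd m)) = oddMax m T := by
  obtain ⟨w, rfl⟩ : ∃ w, m = w + 1 := ⟨m - 1, by omega⟩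
  have key := three_mul_arrayGain_of_full (b := cnt (w + 1) (2 * T + 1)
    (packed (w + 1) (2 * T + 1) (fun _ => 0) (lastInd (w + 1)))) w T (fun _ _ => 0) (by simp)
    (fun r hr k hk => by
      rw [cnt_packed (by omega), lastInd_of_lt (by omega)]
      omega)
    (fun r hr => by
      rw [cnt_packed (by omega), lastInd, if_pos rfl]
      omega)
  rw [twiceSize_packed_lastInd hm (by omega), show (2 * T + 1) / 2 = T by omega]
  simpa using key

/-- Outside the last column every block misses just its top residue, so its defect is twice its
size: exactly the loss built into `three_mul_arrayGain_of_full` with `τ = 1`. -/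
theorem three_mul_twiceSize_zero_one {T : ℕ} (hm : 2 ≤ m) (hT : 1 ≤ T) :
    3 * twiceSize (packed m (2 * T + 1) (fun _ => 0) (fun _ => 1)) = oddMax m T := by
  obtain ⟨w, rfl⟩ : ∃ w, m = w + 1 := ⟨m - 1, by omega⟩
  have hb : ∀ r < T, ∀ k < w + 1, cnt (w + 1) (2 * T + 1)
      (packed (w + 1) (2 * T + 1) (fun _ => 0) (fun _ => 1)) r k = 2 * T - 2 * r - 1 :=
    fun r hr k hk => by
      rw [cnt_packed hk]
      omega
  have key := three_mul_arrayGain_of_full (b := cnt (w + 1) (2 * T + 1)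
    (packed (w + 1) (2 * T + 1) (fun _ => 0) (fun _ => 1))) w T (fun _ _ => 1) (by simp)
    (fun r hr k hk => hb r hr k (by omega)) (fun r hr => hb r hr w (by omega))
  rw [twiceSize_eq hm (by omega) (packed_subset hm (by omega) le_rfl),
    show (2 * T + 1) / 2 = T by omega]
  have hd : ∑ r ∈ range T, ∑ k ∈ range (w + 1), defect (res (2 * T + 1)
      (packed (w + 1) (2 * T + 1) (fun _ => 0) (fun _ => 1)) (r * (w + 1) + k))
        (top (w + 1) (2 * T + 1) r k) =
      2 * ∑ r ∈ range T, ∑ k ∈ range w, 1 * cnt (w + 1) (2 * T + 1)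
        (packed (w + 1) (2 * T + 1) (fun _ => 0) (fun _ => 1)) r k := by
    rw [mul_sum]
    refine sum_congr rfl fun r hr => ?_
    have hr := mem_range.1 hr
    rw [sum_range_succ, mul_sum, top_last rfl, res_packed (by omega), defect_Ico, add_zero]
    refine sum_congr rfl fun k hk => ?_
    have hk := mem_range.1 hk
    rw [top_of_lt (by omega), res_packed (by omega), cnt, res_packed (by omega),
      show 2 * T + 1 - r = 2 * T + 1 - r - 1 + 1 by omega, Nat.add_sub_cancel, defect_add,
      defect_Ico]
    push_cast
    ring
  rw [hd, key]
  have h1 : ∑ r ∈ range T, ∑ k ∈ range w, (2 * (r : ℤ) - (T - 1)) * 1 = 0 := by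
    rw [sum_comm]
    simp only [mul_one, sum_centered, sum_const_zero]
  have h2 : ∑ r ∈ range T, ∑ k ∈ range w, (2 * (k : ℤ) - (w - 1)) * 1 = 0 := by
    simp only [mul_one, sum_centered, sum_const_zero]
  rw [h1, h2]
  simp

end GenBeta

/-! ### The sharp bounds for generalized-β-sets -/

namespace GenBeta

open Finset

variable {m s T : ℕ} {S : Finset ℕ} {α β : ℕ → ℕ}

theorem eq_packed (hm : 2 ≤ m) (hs : 2 ≤ s) (hS : (S : Set ℕ) ⊆ bigL m s)
    (h : ∀ r < s / 2, ∀ k < m, res s S (r * m + k) = Ico (r + 1 + α k) (s - r - β k)) :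
    S = packed m s α β := by
  refine ext_of_res (s := s) (by omega) fun q => ?_
  have hk : q % m < m := Nat.mod_lt _ (by omega)
  rw [← Nat.div_add_mod' q m, res_packed hk]
  rcases Nat.lt_or_ge (q / m) (s / 2) with hr | hr
  · exact h _ hr _ hk
  · have h1 := res_subset hm hs hS (r := q / m) hk
    have h2 := top_le (m := m) (s := s) (r := q / m) (k := q % m)
    rw [Ico_eq_empty (by omega), subset_empty] at h1
    rw [h1, Ico_eq_empty (by omega)]

theorem IsGenBetaSet.le_evenMax (h : IsGenBetaSet m (2 * T) S) (hm : 2 ≤ m) (hT : 1 ≤ T) :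
    3 * twiceSize S ≤ evenMax m T ∧
      (3 * twiceSize S = evenMax m T → S = packed m (2 * T) (fun _ => 0) (lastInd m) ∨
        S = packed m (2 * T) (lastInd m) (lastInd m)) := by
  have hs : 2 ≤ 2 * T := by omega
  have hT2 : 2 * T / 2 = T := Nat.mul_div_cancel_left _ two_pos
  obtain ⟨R, p, hsh⟩ := h.exists_shape hm hs
  have hle := h.twiceSize_le hm hs
  rw [hT2] at hsh hle
  suffices hlt : 3 * arrayGain m (2 * T) T (cnt m (2 * T) S) < evenMax m T ∨
      R + 1 = T ∧ p + 1 = m by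
    rcases hlt with hlt | ⟨hR, hp⟩
    · exact ⟨by linarith, fun _ => by linarith⟩
    have hpm := hsh.p_lt
    subst hR
    obtain ⟨h1, h2⟩ := hsh.le_evenMax hp
    refine ⟨by linarith, fun heq => ?_⟩
    have hd0 := twiceSize_eq hm hs h.subset
    rw [hT2] at hd0
    -- Equality leaves no room for defects, so every block is the top segment of its window and is
    -- determined by its size.
    have hz : ∑ r ∈ range (R + 1), ∑ k ∈ range m,
        defect (res (2 * (R + 1)) S (r * m + k)) (top m (2 * (R + 1)) r k) = 0 := by
      have := sum_nonneg fun r (_ : r ∈ range (R + 1)) => sum_nonneg fun k hk =>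
        h.defect_nonneg hm hs (r := r) (k := k) (mem_range.1 hk)
      linarith
    rw [sum_eq_zero_iff_of_nonneg fun r _ => sum_nonneg fun k hk =>
      h.defect_nonneg hm hs (mem_range.1 hk)] at hz
    have hres : ∀ r < R + 1, ∀ k < m, res (2 * (R + 1)) S (r * m + k) =
        Ico (2 * (R + 1) - r - lastInd m k - (res (2 * (R + 1)) S (r * m + k)).card)
          (2 * (R + 1) - r - lastInd m k) := fun r hr k hk => by
      have h3 := hz r (mem_range.2 hr)
      rw [sum_eq_zero_iff_of_nonneg fun k hk => h.defect_nonneg hm hs (mem_range.1 hk)] at h3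
      exact (defect_nonneg_and fun _ hx =>
        (mem_Ico.1 (res_subset hm hs h.subset hk hx)).2).2 (h3 k (mem_range.2 hk))
    have hcol : ∀ r < R + 1, ∀ k < p,
        ((res (2 * (R + 1)) S (r * m + k)).card : ℤ) = 2 * R + 1 - 2 * r :=
      fun r hr k hk => hsh.eq_of_full_column hr hk
    have hlast : ((res (2 * (R + 1)) S (R * m + p)).card : ℤ) = 0 :=
      hsh.zero_last p le_rfl hpm
    have hres' : ∀ α : ℕ → ℕ, (∀ k < p, α k = 0) → (∀ r < R,
        ((res (2 * (R + 1)) S (r * m + p)).card : ℤ) = 2 * R - 2 * r - α p) →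
        S = packed m (2 * (R + 1)) α (lastInd m) := fun α h0 hα => by
      refine eq_packed hm hs h.subset fun r hr k hk => ?_
      rw [hT2] at hr
      rw [hres r hr k hk]
      rcases Nat.lt_or_ge k p with hkp | hkp
      · have h3 := hcol r hr k hkp
        rw [lastInd_of_lt (by omega), h0 k hkp]
        congr 1
        omega
      · obtain rfl : k = p := by omega
        rw [lastInd, if_pos hp]
        rcases Nat.lt_or_ge r R with hrR | hrR
        · have h3 := hα r hrR
          rcases Nat.eq_zero_or_pos (res (2 * (R + 1)) S (r * m + k)).card with h4 | h4
          · rw [h4, Ico_eq_empty (by omega), Ico_eq_empty (by omega)]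
          · congr 1
            omega
        · obtain rfl : r = R := by omega
          rw [Ico_eq_empty (by omega), Ico_eq_empty (by omega)]
    rcases h2 (by linarith) with h3 | h3
    · exact Or.inl (hres' _ (fun _ _ => rfl) fun r hr => by rw [← cnt, h3 r hr]; simp)
    · refine Or.inr (hres' _ (fun k hk => lastInd_of_lt (by omega)) fun r hr => ?_)
      rw [← cnt, h3 r hr, lastInd, if_pos hp, Nat.cast_one]
  have hRT := hsh.R_le
  have hpm := hsh.p_lt
  rcases hRT.eq_or_lt with hRT | hRT
  -- `R = T` is impossible: the last block of row `T - 1` would be nonempty in a window of `s - 2 -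
  -- 2(T-1) = 0` places.
  · obtain ⟨U, rfl⟩ : ∃ U, T = U + 1 := ⟨T - 1, by omega⟩
    have h1 := hsh.cap_last U (by omega)
    have h2 := hsh.pos U (m - 1) (by omega) (by omega)
    push_cast at h1
    omega
  · rcases Nat.lt_or_ge (R + 1) T with hR | hR
    · exact Or.inl (hsh.lt_evenMax_of_add_two_le hm hR)
    · have hR : R + 1 = T := by omega
      rcases Nat.eq_zero_or_pos p with rfl | hp
      · exact Or.inl (hsh.lt_evenMax_of_empty_last_row hm hR)
      · rcases Nat.lt_or_ge (p + 1) m with hp1 | hp1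
        · exact Or.inl (hsh.lt_evenMax_of_last_row hR hp hp1)
        · exact Or.inr ⟨hR, by omega⟩

/-- The factor `2T - 2r - cnt` is `0` or `1`. If it is `1`, the block ties with the last block of
its row, so it misses the residue `s - r - 1` and loses twice its size. -/
theorem IsGenBetaSet.le_defect (h : IsGenBetaSet m (2 * T + 1) S) (hm : 2 ≤ m) (hT : 1 ≤ T)
    (hsh : Shape m (2 * T + 1) T T 0 (cnt m (2 * T + 1) S)) {r k : ℕ} (hr : r < T)
    (hk : k + 1 < m) :
    2 * ((2 * T - 2 * r - cnt m (2 * T + 1) S r k) * cnt m (2 * T + 1) S r k) ≤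
      defect (res (2 * T + 1) S (r * m + k)) (top m (2 * T + 1) r k) := by
  have hs : 2 ≤ 2 * T + 1 := by omega
  have h1 := hsh.cap r k hr hk
  have h2 := hsh.odd_bounds hr (k := k) (by omega)
  have h3 := hsh.odd_bounds hr (k := m - 1) (by omega)
  have h4 := hsh.cap_last r hr
  push_cast at h1 h4
  rcases eq_or_ne (cnt m (2 * T + 1) S r k) (2 * T - 2 * r) with h5 | h5
  · rw [h5, sub_self, zero_mul, mul_zero]
    exact h.defect_nonneg hm hs (by omega)
  · have h6 := h.lt_of_tie hm hs (r := r) (k := k) (by omega) (by omega)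
    have h7 := (defect_nonneg_and h6).1
    rw [top_of_lt hk, show 2 * T + 1 - r = 2 * T + 1 - r - 1 + 1 by omega, defect_add,
      show 2 * (T : ℤ) - 2 * r - cnt m (2 * T + 1) S r k = 1 by omega, cnt]
    push_cast
    linarith

theorem IsGenBetaSet.le_oddMax (h : IsGenBetaSet m (2 * T + 1) S) (hm : 2 ≤ m) (hT : 1 ≤ T) :
    3 * twiceSize S ≤ oddMax m T ∧
      (3 * twiceSize S = oddMax m T → S = packed m (2 * T + 1) (fun _ => 0) (lastInd m) ∨
        S = packed m (2 * T + 1) (fun _ => 0) (fun _ => 1)) := by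
  have hs : 2 ≤ 2 * T + 1 := by omega
  have hT2 : (2 * T + 1) / 2 = T := by omega
  obtain ⟨R, p, hsh⟩ := h.exists_shape hm hs
  have hle := h.twiceSize_le hm hs
  rw [hT2] at hsh hle
  have hpm := hsh.p_lt
  suffices hlt : 3 * arrayGain m (2 * T + 1) T (cnt m (2 * T + 1) S) < oddMax m T ∨ R = T by
    rcases hlt with hlt | rfl
    · exact ⟨by linarith, fun _ => by linarith⟩
    obtain rfl : p = 0 := by
      by_contra hp
      exact lt_irrefl _ (hsh.R_lt (Nat.pos_of_ne_zero hp))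
    obtain ⟨w, rfl⟩ : ∃ w, m = w + 1 := ⟨m - 1, by omega⟩
    obtain ⟨h1, h2⟩ := hsh.le_oddMax (by omega)
    have hd := twiceSize_eq hm hs h.subset
    rw [hT2] at hd
    have hd2 : 2 * ∑ r ∈ range R, ∑ k ∈ range w, (2 * R - 2 * r -
        cnt (w + 1) (2 * R + 1) S r k) * cnt (w + 1) (2 * R + 1) S r k ≤
        ∑ r ∈ range R, ∑ k ∈ range (w + 1),
          defect (res (2 * R + 1) S (r * (w + 1) + k)) (top (w + 1) (2 * R + 1) r k) := by
      rw [mul_sum]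
      refine sum_le_sum fun r hr => ?_
      rw [mul_sum, sum_range_succ]
      refine le_add_of_le_of_nonneg (sum_le_sum fun k hk => ?_)
        (h.defect_nonneg hm hs (Nat.lt_succ_self w))
      exact h.le_defect hm hT hsh (mem_range.1 hr) (Nat.succ_lt_succ (mem_range.1 hk))
    refine ⟨by linarith, fun heq => ?_⟩
    have hlast : ∀ r < R, cnt (w + 1) (2 * R + 1) S r w = 2 * R - 2 * r - 1 := fun r hr => by
      have h3 := hsh.odd_bounds hr (Nat.lt_succ_self w)
      have h4 := hsh.cap_last r hr
      rw [Nat.add_sub_cancel] at h4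
      push_cast at h4
      linarith
    rcases h2 (by linarith) with h3 | h3
    · refine Or.inl (eq_packed hm hs h.subset fun r hr k hk => ?_)
      rw [hT2] at hr
      refine eq_of_subset_of_card_le (res_subset hm hs h.subset hk) ?_
      rw [Nat.card_Ico]
      rcases Nat.lt_or_ge k w with hkw | hkw
      · have h4 := h3 r hr k hkw
        rw [cnt] at h4
        rw [lastInd_of_lt (by omega)]
        omega
      · obtain rfl : k = w := by omega
        have h4 := hlast r hr
        rw [cnt] at h4
        rw [lastInd, if_pos rfl]
        omega
    · refine Or.inr (eq_packed hm hs h.subset fun r hr k hk => ?_)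
      rw [hT2] at hr
      have h4 : cnt (w + 1) (2 * R + 1) S r k = 2 * R - 2 * r - 1 := by
        rcases Nat.lt_or_ge k w with hkw | hkw
        · exact h3 r hr k hkw
        · obtain rfl : k = w := by omega
          exact hlast r hr
      refine eq_of_subset_of_card_le (fun ρ hρ => mem_Ico.2 ⟨?_, ?_⟩) ?_
      · exact (mem_Ico.1 (res_subset hm hs h.subset hk hρ)).1
      · exact h.lt_of_tie hm hs hk (h4.trans (hlast r hr).symm) ρ hρ
      · rw [cnt] at h4
        rw [Nat.card_Ico]
        omega
  rcases hsh.R_le.eq_or_lt with hRT | hRT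
  · exact Or.inr hRT
  · rcases Nat.lt_or_ge (R + 1) T with hR | hR
    · exact Or.inl (hsh.lt_oddMax_of_add_two_le hm hR)
    · have hR : R + 1 = T := by omega
      rcases Nat.eq_zero_or_pos p with rfl | hp
      · exact Or.inl (hsh.lt_oddMax_of_empty_last_row hm hR)
      · exact Or.inl (hsh.lt_oddMax_of_last_row hR hp)

end GenBeta

/-! ### Identification of the maximizers -/

namespace GenBeta

open Finset

variable {m s T : ℕ} {α β : ℕ → ℕ}

theorem sizeCount_le_iff {S S' : Finset ℕ} :
    sizeCount S ≤ sizeCount S' ↔ twiceSize S ≤ twiceSize S' := by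
  rw [← Int.cast_le (R := ℚ), ← two_mul_sizeCount, ← two_mul_sizeCount]
  constructor <;> intro h <;> linarith

theorem isMaximizer_iff_of_bound {A B : Finset ℕ} {c : ℤ} (hA : IsGenBetaSet m s A)
    (hB : IsGenBetaSet m s B) (hA' : 3 * twiceSize A = c) (hB' : 3 * twiceSize B = c)
    (h : ∀ S, IsGenBetaSet m s S →
      3 * twiceSize S ≤ c ∧ (3 * twiceSize S = c → S = A ∨ S = B)) (S : Finset ℕ) :
    IsMaximizer m s S ↔ S = A ∨ S = B := by
  constructor
  · rintro ⟨h1, h2⟩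
    have h3 := sizeCount_le_iff.1 (h2 A hA)
    exact (h S h1).2 (by linarith [(h S h1).1])
  · rintro (rfl | rfl)
    · exact ⟨hA, fun S' hS' => sizeCount_le_iff.2 (by linarith [(h S' hS').1])⟩
    · exact ⟨hB, fun S' hS' => sizeCount_le_iff.2 (by linarith [(h S' hS').1])⟩

theorem isMaximizer_even_iff (hm : 2 ≤ m) (hT : 1 ≤ T) (S : Finset ℕ) :
    IsMaximizer m (2 * T) S ↔ S = packed m (2 * T) (fun _ => 0) (lastInd m) ∨
      S = packed m (2 * T) (lastInd m) (lastInd m) :=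
  isMaximizer_iff_of_bound ((isMargin_zero_lastInd (by omega)).isGenBetaSet hm (by omega))
    ((isMargin_lastInd_lastInd (by omega)).isGenBetaSet hm (by omega))
    (three_mul_twiceSize_zero_lastInd_even hm hT) (three_mul_twiceSize_lastInd_lastInd hm hT)
    (fun _ h => h.le_evenMax hm hT) S

theorem isMaximizer_odd_iff (hm : 2 ≤ m) (hT : 1 ≤ T) (S : Finset ℕ) :
    IsMaximizer m (2 * T + 1) S ↔ S = packed m (2 * T + 1) (fun _ => 0) (lastInd m) ∨
      S = packed m (2 * T + 1) (fun _ => 0) (fun _ => 1) :=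
  isMaximizer_iff_of_bound ((isMargin_zero_lastInd (by omega)).isGenBetaSet hm (by omega))
    ((isMargin_zero_one ⟨T, rfl⟩).isGenBetaSet hm (by omega))
    (three_mul_twiceSize_zero_lastInd_odd hm hT) (three_mul_twiceSize_zero_one hm hT)
    (fun _ h => h.le_oddMax hm hT) S

theorem oddCase2_packed (hm : 2 ≤ m) (hT : 1 ≤ T) :
    OddCase2 m (2 * T + 1) (packed m (2 * T + 1) (fun _ => 0) (lastInd m)) := by
  have hN := (isMargin_zero_lastInd (m := m) (s := 2 * T + 1) (by omega)).numRows_packed hm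
    (by omega)
  obtain ⟨U, rfl⟩ : ∃ U, T = U + 1 := ⟨T - 1, by omega⟩
  rw [show (2 * (U + 1) + 1) / 2 = U + 1 by omega] at hN
  unfold OddCase2
  rw [hN, Nat.add_sub_cancel (n := U), add_mul, one_mul]
  refine ⟨by omega, fun i h1 h2 => ?_, ?_⟩
  · obtain ⟨k, rfl⟩ : ∃ k, i = U * m + k + 1 := ⟨i - (U * m + 1), by omega⟩
    rw [a_packed (by omega), lastInd_of_lt (by omega)]
    omega
  · rw [show U * m + m = U * m + (m - 1) + 1 by omega, a_packed (by omega),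
      lastInd_sub_one (by omega)]
    omega

theorem oddCase1_packed (hm : 2 ≤ m) (hT : 1 ≤ T) :
    OddCase1 m (2 * T + 1) (packed m (2 * T + 1) (fun _ => 0) (fun _ => 1)) := by
  have hN := (isMargin_zero_one (m := m) (s := 2 * T + 1) ⟨T, rfl⟩).numRows_packed hm (by omega)
  obtain ⟨U, rfl⟩ : ∃ U, T = U + 1 := ⟨T - 1, by omega⟩
  rw [show (2 * (U + 1) + 1) / 2 = U + 1 by omega] at hN
  unfold OddCase1
  rw [hN, Nat.add_sub_cancel (n := U), add_mul, one_mul]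
  refine ⟨by omega, fun i h1 h2 => ?_⟩
  obtain ⟨k, rfl⟩ : ∃ k, i = U * m + k + 1 := ⟨i - (U * m + 1), by omega⟩
  rw [a_packed (by omega)]
  omega

theorem OddCase1.not_oddCase2 {S : Finset ℕ} (hm : 2 ≤ m) (hs : 0 < s) (h : OddCase1 m s S) :
    ¬ OddCase2 m s S := fun h' => by
  have h1 := (numRows_spec (m := m) (s := s) (by omega) hs S).1
  have h2 := Nat.succ_mul (numRows m s S - 1) m
  rw [Nat.succ_eq_add_one, Nat.sub_add_cancel h1] at h2
  have h3 := h.2 _ le_rfl (by omega)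
  -- As `m ≥ 2`, the first block of row `t` is not its last, so the two cases prescribe sizes `1`
  -- and `2` for it.
  have h4 := h'.2.1 _ le_rfl (by omega)
  omega

theorem IsMargin.evenLastRow_packed (h : IsMargin m (2 * T) α (lastInd m)) (hm : 2 ≤ m)
    (hT : 1 ≤ T) (hα : ∀ k, k + 1 < m → α k = 0) :
    EvenLastRow m (2 * T) (packed m (2 * T) α (lastInd m)) := by
  have hN := h.numRows_packed hm (by omega)
  obtain ⟨U, rfl⟩ : ∃ U, T = U + 1 := ⟨T - 1, by omega⟩
  rw [show 2 * (U + 1) / 2 = U + 1 by omega] at hN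
  unfold EvenLastRow
  rw [hN, Nat.add_sub_cancel (n := U), add_mul, one_mul]
  refine ⟨by omega, fun i h1 h2 => ?_, ?_⟩
  · obtain ⟨k, rfl⟩ : ∃ k, i = U * m + k + 1 := ⟨i - (U * m + 1), by omega⟩
    rw [a_packed (by omega), lastInd_of_lt (by omega), hα k (by omega)]
    omega
  · rw [show U * m + m = U * m + (m - 1) + 1 by omega, a_packed (by omega),
      lastInd_sub_one (by omega)]
    omega

theorem a_packed_last_column (hm : 0 < m) (hT : 2 ≤ T) :
    a (2 * T) (packed m (2 * T) α (lastInd m)) ((T - 1) * m) = 2 - α (m - 1) := by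
  obtain ⟨U, rfl⟩ : ∃ U, T = U + 2 := ⟨T - 2, by omega⟩
  rw [show (U + 2 - 1) * m = U * m + (m - 1) + 1 by
      rw [show U + 2 - 1 = U + 1 by omega, add_mul]
      omega,
    a_packed (by omega), lastInd_sub_one hm]
  omega

theorem evenCase2_packed (hm : 2 ≤ m) (hT : 2 ≤ T) :
    EvenCase2 m (2 * T) (packed m (2 * T) (fun _ => 0) (lastInd m)) := by
  have h := (isMargin_zero_lastInd (m := m) (s := 2 * T) (by omega)).evenLastRow_packed hm
    (by omega) fun _ _ => rfl
  refine ⟨h, ?_⟩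
  rw [h.1, Nat.mul_div_cancel_left _ two_pos]
  exact a_packed_last_column (by omega) hT

theorem evenCase1_packed (hm : 2 ≤ m) (hT : 2 ≤ T) :
    EvenCase1 m (2 * T) (packed m (2 * T) (lastInd m) (lastInd m)) := by
  have h := (isMargin_lastInd_lastInd (m := m) (s := 2 * T) (by omega)).evenLastRow_packed hm
    (by omega) fun _ hk => lastInd_of_lt hk
  refine ⟨h, ?_⟩
  rw [h.1, Nat.mul_div_cancel_left _ two_pos, a_packed_last_column (by omega) hT,
    lastInd_sub_one (by omega)]

/-- For `s = 2` there is a single row and its last block is empty anyway, so the two candidates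
coincide; hence the unique maximizer in (iii). -/
theorem packed_two_eq (hm : 2 ≤ m) :
    packed m 2 (lastInd m) (lastInd m) = packed m 2 (fun _ => 0) (lastInd m) := by
  refine eq_packed hm le_rfl (packed_subset hm le_rfl (lastInd_sub_one (by omega)).ge)
    fun r hr k hk => ?_
  rw [res_packed hk]
  rcases Nat.lt_or_ge (k + 1) m with h | h
  · rw [lastInd_of_lt h]
  · rw [lastInd, if_pos (by omega), Ico_eq_empty (by omega), Ico_eq_empty (by omega)]

theorem cases_of_iff {X : Type*} {M P Q : X → Prop} {A B : X} (hM : ∀ S, M S ↔ S = A ∨ S = B)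
    (hP : P B) (hQ : Q A) (hPQ : ∀ S, P S → ¬ Q S) :
    (∀ S, M S → P S ∨ Q S) ∧ (∃! S, M S ∧ P S) ∧ ∃! S, M S ∧ Q S := by
  refine ⟨fun S hS => ?_, ⟨B, ⟨(hM B).2 (Or.inr rfl), hP⟩, fun S hS => ?_⟩,
    ⟨A, ⟨(hM A).2 (Or.inl rfl), hQ⟩, fun S hS => ?_⟩⟩
  · rcases (hM S).1 hS with rfl | rfl
    · exact Or.inr hQ
    · exact Or.inl hP
  · exact ((hM S).1 hS.1).resolve_left fun h => hPQ S hS.2 (h ▸ hQ)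
  · exact ((hM S).1 hS.1).resolve_right fun h => hPQ S (h ▸ hP) hS.2

end GenBeta

theorem mainTheorem2 (m s : ℕ) (hm : 2 ≤ m) (hs : 2 ≤ s) :
    (Odd s →
      (∀ S, GenBeta.IsMaximizer m s S → GenBeta.OddCase1 m s S ∨ GenBeta.OddCase2 m s S) ∧
      (∃! S, GenBeta.IsMaximizer m s S ∧ GenBeta.OddCase1 m s S) ∧
      (∃! S, GenBeta.IsMaximizer m s S ∧ GenBeta.OddCase2 m s S)) ∧
    (Even s → 4 ≤ s →
      (∀ S, GenBeta.IsMaximizer m s S → GenBeta.EvenCase1 m s S ∨ GenBeta.EvenCase2 m s S) ∧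
      (∃! S, GenBeta.IsMaximizer m s S ∧ GenBeta.EvenCase1 m s S) ∧
      (∃! S, GenBeta.IsMaximizer m s S ∧ GenBeta.EvenCase2 m s S)) ∧
    (s = 2 →
      (∀ S, GenBeta.IsMaximizer m s S → GenBeta.EvenLastRow m s S) ∧
      (∃! S, GenBeta.IsMaximizer m s S)) := by
  refine ⟨?_, ?_, ?_⟩
  · rintro ⟨T, rfl⟩
    exact GenBeta.cases_of_iff (GenBeta.isMaximizer_odd_iff hm (by omega))
      (GenBeta.oddCase1_packed hm (by omega)) (GenBeta.oddCase2_packed hm (by omega))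
      fun S h => h.not_oddCase2 hm (by omega)
  · intro he h4
    obtain ⟨T, rfl⟩ := even_iff_two_dvd.1 he
    exact GenBeta.cases_of_iff (GenBeta.isMaximizer_even_iff hm (by omega))
      (GenBeta.evenCase1_packed hm (by omega)) (GenBeta.evenCase2_packed hm (by omega))
      fun S h h' => absurd (h.2.symm.trans h'.2) (by decide)
  · rintro rfl
    have hM : ∀ S, GenBeta.IsMaximizer m 2 S ↔
        S = GenBeta.packed m 2 (fun _ => 0) (GenBeta.lastInd m) := fun S => by
      have := GenBeta.isMaximizer_even_iff (T := 1) hm le_rfl S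
      rwa [mul_one, GenBeta.packed_two_eq hm, or_self] at this
    refine ⟨fun S hS => ?_, ⟨_, (hM _).2 rfl, fun S hS => (hM S).1 hS⟩⟩
    rw [(hM S).1 hS]
    exact (GenBeta.isMargin_zero_lastInd (m := m) (s := 2 * 1) (by omega)).evenLastRow_packed hm
      le_rfl fun _ _ => rfl
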